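/- All manifolds are smooth and finite-dimensional, and all functions, sections, vector fields and forms are smooth. **Setting.** Let $\mathfrak g$ be a finite-dimensional real Lie algebra with bracket $\{\cdot,\cdot\}$, $\mathfrak h\subset\mathfrak g$ a subalgebra, and $H$ a Lie group with Lie algebra $\mathfrak h$. Let $\mathrm{Ad}$ be a smooth representation of $H$ on $\mathfrak g$ by Lie algebra automorphisms which restricts to the adjoint representation of $H$ on $\mathfrak h$ and whose derivative at the identity is the adjoint action of $\mathfrak h$ on $\mathfrak g$. Let $M$ be a Hausdorff, second countable manifold. A *Cartan geometry* on $M$ with this model consists of a smooth principal right $H$-bundle $\pi:P\to M$ and a $\mathfrak g$-valued $1$-form $\omega$ on $P$ such that each $\omega_p:T_pP\to\mathfrak g$ is a linear isomorphism, $R_h^*\omega=\mathrm{Ad}(h^{-1})\omega$ for $h\in H$, and $\omega(\tilde\xi)=\xi$ for $\xi\in\mathfrak h$, where $\tilde\xi$ is the fundamental vector field generated by $\xi$. Let $\bar{\mathfrak g}=P\times_H\mathfrak g\to M$ be the adjoint tractor bundle. Its sections are identified with the functions $\sigma:P\to\mathfrak g$ satisfying $\sigma(ph)=\mathrm{Ad}(h^{-1})\sigma(p)$;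 they form a module over $C^\infty(M)$ and carry the pointwise bracket $\{\sigma,\tau\}$. For $\sigma\in\Gamma(\bar{\mathfrak g})$ let $X_\sigma$ be the ($H$-invariant) vector field on $P$ with $\omega(X_\sigma)=\sigma$, and for sections $\sigma,\tau$ put $$\Pi(\sigma)=\pi_*X_\sigma,\qquad [\![\sigma,\tau]\!]=\omega([X_\sigma,X_\tau]),\qquad D_\sigma\tau=X_\sigma(\tau).$$ Let $\Omega(X,Y)=d\omega(X,Y)+\{\omega(X),\omega(Y)\}$, where $d\omega(X,Y)=X(\omega(Y))-Y(\omega(X))-\omega([X,Y])$. The curvature $\kappa$ of the geometry is $\Omega$ regarded as a $2$-form on $M$ with values in $\bar{\mathfrak g}$: for vector fields $U,V$ on $M$, $\kappa(U,V)(p)=\Omega_p(u,v)$ for all $u,v\in T_pP$ with $\pi_*u=U_{\pi(p)}$ and $\pi_*v=V_{\pi(p)}$. **Theorem.** For every Cartan geometry as above: 1. $(\bar{\mathfrak g},\Pi,[\![\cdot,\cdot]\!])$ is a Lie algebroid over $M$, and $D$ is a representation of it on $\bar{\mathfrak g}$ (the fundamental self-representation), i.e. $D_\sigma\tau$ is $\mathbb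 R$-linear in both arguments, $C^\infty(M)$-linear in $\sigma$, and satisfies $D_\sigma(f\tau)=fD_\sigma\tau+\Pi(\sigma)(f)\tau$ and $D_{[\![\rho,\sigma]\!]}=D_\rho D_\sigma-D_\sigma D_\rho$. 2. $\kappa$ is well defined (it exists and is unique), and every vector field on $M$ is of the form $\Pi(\rho)$. There is exactly one operator $\nabla^{T}$ and exactly one operator $\nabla^{C}$ such that for every vector field $U$ on $M$, every $\sigma\in\Gamma(\bar{\mathfrak g})$ and every $\rho\in\Gamma(\bar{\mathfrak g})$ with $\Pi(\rho)=U$ $$\nabla^{T}_U\sigma=D_\rho\sigma+\{\rho,\sigma\},\qquad \nabla^{C}_U\sigma=D_\sigma\rho-[\![\sigma,\rho]\!].$$ Both are linear connections (covariant derivatives) on $\bar{\mathfrak g}$: the tractor connection and Blaom's Cartan connection. 3. $\nabla=\nabla^{C}$ is compatible with the algebroid bracket in Blaom's sense: for every vector field $U$ on $M$ and all $\sigma,\tau\in\Gamma(\bar{\mathfrak g})$, $$\nabla_U[\![\sigma,\tau]\!]=[\![\nabla_U\sigma,\tau]\!]+[\![\sigma,\nabla_U\tau]\!]+\nabla_{\nabla^*_\tau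 U}\sigma-\nabla_{\nabla^*_\sigma U}\tau,\qquad\text{where }\ \nabla^*_\sigma U=\Pi(\nabla_U\sigma)+[\Pi(\sigma),U].$$ 4. The two connections differ by the curvature: for all $\rho,\sigma\in\Gamma(\bar{\mathfrak g})$, $$\nabla^{T}_{\Pi(\rho)}\sigma-\nabla^{C}_{\Pi(\rho)}\sigma=\kappa(\Pi(\rho),\Pi(\sigma)).$$ -/

import Mathlib

set_option linter.unusedSectionVars false
set_option linter.unusedVariables false

open Set Function Bundle MulOpposite VectorField
open scoped Manifold ContDiff Bundle

noncomputable section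

/-! ### Preliminaries on normed Lie algebras and Lie groups -/

/-- A real Lie algebra carrying a norm, which is used (in finite dimension) only to speak of smooth
functions with values in the Lie algebra. The bracket is the bracket of the Lie algebra. -/
class NormedLieAlgebra (L : Type*) extends
  NormedAddCommGroup L, LieRing L, NormedSpace ℝ L, LieAlgebra ℝ L

/-- The bracket of a finite-dimensional real Lie algebra, as a continuous bilinear map. -/
def NormedLieAlgebra.bracketL (L : Type*) [NormedLieAlgebra L] [FiniteDimensional ℝ L] :
    L →L[ℝ] L →L[ℝ] L :=
  (LinearMap.mk₂ ℝ (fun x y : L => ⁅x, y⁆)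
    add_lie smul_lie lie_add lie_smul).toContinuousBilinearMap

theorem NormedLieAlgebra.bracketL_apply {L : Type*} [NormedLieAlgebra L] [FiniteDimensional ℝ L]
    (x y : L) : bracketL L x y = ⁅x, y⁆ := rfl

/-- A smooth Lie group has the regularity which Mathlib asks for to define its Lie algebra. -/
instance lieGroupMinSmoothness {EH H : Type*} [NormedAddCommGroup EH] [NormedSpace ℝ EH]
    [TopologicalSpace H] [ChartedSpace EH H] [Group H] [LieGroup 𝓘(ℝ, EH) ∞ H] :
    LieGroup 𝓘(ℝ, EH) (minSmoothness ℝ 3) H := by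
  rw [minSmoothness_of_isRCLikeNormedField]; infer_instance

/-! ### Smooth functions and smooth vector fields -/

section VectorFields

variable {E N : Type*} [NormedAddCommGroup E] [NormedSpace ℝ E]
  [TopologicalSpace N] [ChartedSpace E N]

variable (E N) in
/-- The ring of smooth real functions on `N`. -/
abbrev SmoothFn := C^∞⟮𝓘(ℝ, E), N; 𝓘(ℝ, ℝ), ℝ⟯

variable [IsManifold 𝓘(ℝ, E) ∞ N]

variable (E N) in
/-- The space of smooth vector fields on `N`. -/
abbrev SmoothVF := Cₛ^∞⟮𝓘(ℝ, E); E, (TangentSpace 𝓘(ℝ, E) : N → Type _)⟯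

/-- The product of a smooth function and a smooth vector field. -/
instance SmoothVF.instSMulFn : SMul (SmoothFn E N) (SmoothVF E N) where
  smul f U := ⟨fun x => f x • U x, f.contMDiff.smul_section U.contMDiff⟩

@[simp] theorem SmoothVF.fn_smul_apply (f : SmoothFn E N) (U : SmoothVF E N) (x : N) :
    (f • U) x = f x • U x := rfl

/-- The derivative of a smooth vector-valued function along a smooth vector field is smooth. -/
theorem contMDiff_mvfderiv_apply {F : Type*} [NormedAddCommGroup F] [NormedSpace ℝ F]
    {g : N → F} (hg : ContMDiff 𝓘(ℝ, E) 𝓘(ℝ, F) ∞ g) (U : SmoothVF E N) :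
    ContMDiff 𝓘(ℝ, E) 𝓘(ℝ, F) ∞ fun x => mvfderiv 𝓘(ℝ, E) g x (U x) :=
  contMDiff_snd_tangentBundle_modelSpace (𝕜 := ℝ) F 𝓘(ℝ, F) |>.comp
    ((hg.contMDiff_tangentMap (m := ∞) (by simp)).comp U.contMDiff)

/-- The derivative `U(f)` of a smooth function along a smooth vector field. -/
def SmoothVF.deriv (U : SmoothVF E N) (f : SmoothFn E N) : SmoothFn E N :=
  ⟨fun x => mvfderiv 𝓘(ℝ, E) f x (U x), contMDiff_mvfderiv_apply f.contMDiff U⟩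

instance isManifold_top_add_one : IsManifold 𝓘(ℝ, E) ((⊤ : ℕ∞) + 1) N := by
  rw [show (((⊤ : ℕ∞) : WithTop ℕ∞) + 1) = ∞ by rfl]; infer_instance

instance isManifold_minSmoothness_two : IsManifold 𝓘(ℝ, E) (minSmoothness ℝ 2) N := by
  rw [minSmoothness_of_isRCLikeNormedField]; infer_instance

instance isManifold_minSmoothness_three : IsManifold 𝓘(ℝ, E) (minSmoothness ℝ 3) N := by
  rw [minSmoothness_of_isRCLikeNormedField]; infer_instance

variable [CompleteSpace E]

/-- The bracket `[U, V]` of smooth vector fields. -/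
def SmoothVF.bracket (U V : SmoothVF E N) : SmoothVF E N :=
  ⟨mlieBracket 𝓘(ℝ, E) U V,
    ContDiff.mlieBracket_vectorField (m := ⊤) (n := ⊤) U.contMDiff V.contMDiff (by simp)⟩

end VectorFields

/-! ### Cartan geometries -/

section Cartan

variable {EH H 𝔤 EP P EM M : Type*}
  [NormedAddCommGroup EH] [NormedSpace ℝ EH] [FiniteDimensional ℝ EH]
  [TopologicalSpace H] [ChartedSpace EH H] [Group H] [LieGroup 𝓘(ℝ, EH) ∞ H]
  [NormedLieAlgebra 𝔤] [FiniteDimensional ℝ 𝔤]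
  [NormedAddCommGroup EP] [NormedSpace ℝ EP] [FiniteDimensional ℝ EP]
  [TopologicalSpace P] [ChartedSpace EP P] [IsManifold 𝓘(ℝ, EP) ∞ P] [MulAction Hᵐᵒᵖ P]
  [NormedAddCommGroup EM] [NormedSpace ℝ EM] [FiniteDimensional ℝ EM]
  [TopologicalSpace M] [ChartedSpace EM M] [IsManifold 𝓘(ℝ, EM) ∞ M]

variable (EH H 𝔤) in
/-- The model of a Cartan geometry: a Lie algebra `𝔤` with a subalgebra `𝔥`, a Lie group `H` with
Lie algebra `𝔥`, and a smooth representation `Ad` of `H` on `𝔤` by automorphisms of the Lie algebra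
which restricts to the adjoint representation of `H` on `𝔥`, and whose derivative is the adjoint
action of `𝔥` on `𝔤`. -/
structure CartanModel where
  /-- the subalgebra `𝔥` of `𝔤` -/
  𝔥 : LieSubalgebra ℝ 𝔤
  /-- the identification of the Lie algebra of `H` with `𝔥` -/
  ι : GroupLieAlgebra 𝓘(ℝ, EH) H ≃ₗ⁅ℝ⁆ 𝔥
  /-- the action of `H` on `𝔤` -/
  Ad : Representation ℝ H 𝔤
  Ad_lie : ∀ (h : H) (x y : 𝔤), Ad h ⁅x, y⁆ = ⁅Ad h x, Ad h y⁆
  Ad_smooth : ∀ x : 𝔤, ContMDiff 𝓘(ℝ, EH) 𝓘(ℝ, 𝔤) ∞ fun h => Ad h x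
  Ad_ι : ∀ (h : H) (ξ : GroupLieAlgebra 𝓘(ℝ, EH) H),
    Ad h (ι ξ) = ι (mfderiv 𝓘(ℝ, EH) 𝓘(ℝ, EH) (fun g : H => h * g * h⁻¹) 1 ξ)
  Ad_deriv : ∀ (ξ : GroupLieAlgebra 𝓘(ℝ, EH) H) (x : 𝔤),
    mvfderiv 𝓘(ℝ, EH) (fun h => Ad h x) (1 : H) ξ = ⁅(ι ξ : 𝔤), x⁆

/-- `proj : P → M` is a smooth principal right `H`-bundle. The right action of `h : H` on `P` is
`p ↦ op h • p`. -/
structure IsSmoothPrincipalBundle (EH H EP EM : Type*) {P M : Type*}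
    [NormedAddCommGroup EH] [NormedSpace ℝ EH]
    [TopologicalSpace H] [ChartedSpace EH H] [Group H]
    [NormedAddCommGroup EP] [NormedSpace ℝ EP] [TopologicalSpace P] [ChartedSpace EP P]
    [MulAction Hᵐᵒᵖ P]
    [NormedAddCommGroup EM] [NormedSpace ℝ EM] [TopologicalSpace M] [ChartedSpace EM M]
    (proj : P → M) : Prop where
  smooth_proj : ContMDiff 𝓘(ℝ, EP) 𝓘(ℝ, EM) ∞ proj
  smooth_act : ContMDiff (𝓘(ℝ, EP).prod 𝓘(ℝ, EH)) 𝓘(ℝ, EP) ∞ fun q : P × H => op q.2 • q.1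
  proj_act : ∀ (h : H) (p : P), proj (op h • p) = proj p
  /-- local triviality: around every point of `M` there is an `H`-equivariant diffeomorphism from
  `proj ⁻¹' U` onto `U × H` over `U` -/
  exists_trivialization : ∀ x : M, ∃ e : Trivialization H proj, x ∈ e.baseSet ∧
    ContMDiffOn 𝓘(ℝ, EP) (𝓘(ℝ, EM).prod 𝓘(ℝ, EH)) ∞ e e.source ∧
    ContMDiffOn (𝓘(ℝ, EM).prod 𝓘(ℝ, EH)) 𝓘(ℝ, EP) ∞ e.toOpenPartialHomeomorph.symm e.target ∧
    ∀ p ∈ e.source, ∀ h : H, e (op h • p) = ((e p).1, (e p).2 * h)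

/-- A Cartan geometry on `M` with total space `P`, with the given model: a principal right
`H`-bundle `P → M` and a smooth `𝔤`-valued one-form `ω` on `P`, the Cartan connection form, such that
every `ω p : T_p P → 𝔤` is an isomorphism (this is contained in the type of `ω`),
`R_h^* ω = Ad (h⁻¹) ω`, and `ω` reproduces the generators of fundamental vector fields. -/
structure CartanGeometry (𝔪 : CartanModel EH H 𝔤) (EP P EM M : Type*)
    [NormedAddCommGroup EP] [NormedSpace ℝ EP]
    [TopologicalSpace P] [ChartedSpace EP P] [IsManifold 𝓘(ℝ, EP) ∞ P] [MulAction Hᵐᵒᵖ P]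
    [NormedAddCommGroup EM] [NormedSpace ℝ EM]
    [TopologicalSpace M] [ChartedSpace EM M] [IsManifold 𝓘(ℝ, EM) ∞ M] where
  /-- the projection of the principal bundle -/
  proj : P → M
  isPrincipal : IsSmoothPrincipalBundle EH H EP EM proj
  /-- the Cartan connection form -/
  form : ∀ p : P, TangentSpace 𝓘(ℝ, EP) p ≃L[ℝ] 𝔤
  /-- `ω` is smooth, as a section of the bundle of linear maps from `TP` to `𝔤` -/
  form_smooth : ContMDiff 𝓘(ℝ, EP) (𝓘(ℝ, EP).prod 𝓘(ℝ, EP →L[ℝ] 𝔤)) ∞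
    fun p : P => (TotalSpace.mk' (EP →L[ℝ] 𝔤) p (form p : TangentSpace 𝓘(ℝ, EP) p →L[ℝ] 𝔤) :
      TotalSpace (EP →L[ℝ] 𝔤) fun p : P => TangentSpace 𝓘(ℝ, EP) p →L[ℝ] Trivial P 𝔤 p)
  form_act : ∀ (h : H) (p : P) (v : TangentSpace 𝓘(ℝ, EP) p),
    form (op h • p) (mfderiv 𝓘(ℝ, EP) 𝓘(ℝ, EP) (fun q : P => op h • q) p v) = 𝔪.Ad h⁻¹ (form p v)
  /-- `ω(ξ̃) = ξ`, where the fundamental vector field `ξ̃` at `p` is the velocity at the identity of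
  the orbit map `h ↦ p h` in the direction `ξ` -/
  form_fundamental : ∀ (p : P) (ξ : GroupLieAlgebra 𝓘(ℝ, EH) H),
    form p (mfderiv 𝓘(ℝ, EH) 𝓘(ℝ, EP) (fun h : H => op h • p) 1 ξ) = 𝔪.ι ξ

namespace CartanGeometry

variable {𝔪 : CartanModel EH H 𝔤} (𝒢 : CartanGeometry 𝔪 EP P EM M)

/-- The space `Γ(𝔤̄)` of sections of the adjoint tractor bundle, that is of the bundle associated
with `P` by the action of `H` on `𝔤`: a section is regarded as a smooth `𝔤`-valued function `σ` on
`P` with `σ(p h) = Ad(h⁻¹) σ(p)`. -/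
def Sections (𝒢 : CartanGeometry 𝔪 EP P EM M) : Submodule ℝ (P → 𝔤) where
  carrier := {σ | ContMDiff 𝓘(ℝ, EP) 𝓘(ℝ, 𝔤) ∞ σ ∧
    ∀ (h : H) (p : P), σ (op h • p) = 𝔪.Ad h⁻¹ (σ p)}
  add_mem' := fun ha hb => ⟨ha.1.add hb.1, fun h p => by simp [ha.2, hb.2]⟩
  zero_mem' := ⟨contMDiff_const, fun h p => by simp⟩
  smul_mem' := fun c σ hσ => ⟨(contDiff_const_smul c).contMDiff.comp hσ.1, fun h p => by simp [hσ.2]⟩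

variable {𝒢}

theorem smooth (σ : 𝒢.Sections) : ContMDiff 𝓘(ℝ, EP) 𝓘(ℝ, 𝔤) ∞ (σ : P → 𝔤) := σ.2.1

theorem act (σ : 𝒢.Sections) (h : H) (p : P) :
    (σ : P → 𝔤) (op h • p) = 𝔪.Ad h⁻¹ ((σ : P → 𝔤) p) := σ.2.2 h p

/-- The product of a smooth function on `M` and a section. -/
instance instSMulFn : SMul (SmoothFn EM M) 𝒢.Sections where
  smul f σ := ⟨fun p => f (𝒢.proj p) • (σ : P → 𝔤) p,
    (f.contMDiff.comp 𝒢.isPrincipal.smooth_proj).smul (smooth σ),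
    fun h p => by simp [𝒢.isPrincipal.proj_act, act σ]⟩

theorem fn_smul_apply (f : SmoothFn EM M) (σ : 𝒢.Sections) (p : P) :
    (f • σ : 𝒢.Sections).1 p = f (𝒢.proj p) • σ.1 p := rfl

theorem smooth_lie {f g : P → 𝔤} (hf : ContMDiff 𝓘(ℝ, EP) 𝓘(ℝ, 𝔤) ∞ f)
    (hg : ContMDiff 𝓘(ℝ, EP) 𝓘(ℝ, 𝔤) ∞ g) :
    ContMDiff 𝓘(ℝ, EP) 𝓘(ℝ, 𝔤) ∞ fun p => ⁅f p, g p⁆ :=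
  (NormedLieAlgebra.bracketL 𝔤).isBoundedBilinearMap.contDiff.contMDiff.comp (hf.prodMk_space hg)

/-- The Lie-algebraic bracket `{σ, τ}` of sections, coming from the bracket of `𝔤`. -/
def lieBr (σ τ : 𝒢.Sections) : 𝒢.Sections :=
  ⟨fun p => ⁅σ.1 p, τ.1 p⁆, smooth_lie (smooth σ) (smooth τ),
    fun h p => by simp only [act, 𝔪.Ad_lie]⟩

/-! #### The invariant vector field of a section -/

theorem smooth_vf (σ : 𝒢.Sections) : ContMDiff 𝓘(ℝ, EP) (𝓘(ℝ, EP).prod 𝓘(ℝ, EP)) ∞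
    fun p => (TotalSpace.mk' EP p ((𝒢.form p).symm (σ.1 p)) : TangentBundle 𝓘(ℝ, EP) P) := by
  intro p₀
  have hA := ((contMDiffAt_hom_bundle _).1 (𝒢.form_smooth p₀)).2
  rw [contMDiffAt_totalSpace]
  refine ⟨contMDiffAt_id, ?_⟩
  dsimp only at hA ⊢
  set A : P → EP →L[ℝ] 𝔤 := fun p => ContinuousLinearMap.inCoordinates EP
    (TangentSpace 𝓘(ℝ, EP)) 𝔤 (Trivial P 𝔤) p₀ p p₀ p (𝒢.form p : TangentSpace 𝓘(ℝ, EP) p →L[ℝ] 𝔤)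
    with hAdef
  set e := trivializationAt EP (TangentSpace 𝓘(ℝ, EP) : P → Type _) p₀ with he
  have key : ∀ p (hp : p ∈ e.baseSet), A p =
      ((e.continuousLinearEquivAt ℝ p hp).symm.trans (𝒢.form p) : EP ≃L[ℝ] 𝔤) := by
    intro p hp
    rw [hAdef]
    dsimp only
    rw [ContinuousLinearMap.inCoordinates_eq hp (by simp)]
    ext v
    simp [he]
  have hb : ∀ᶠ p in nhds p₀, p ∈ e.baseSet :=
    e.open_baseSet.mem_nhds (FiberBundle.mem_baseSet_trivializationAt' p₀)
  have hinv : ContMDiffAt 𝓘(ℝ, EP) 𝓘(ℝ, 𝔤 →L[ℝ] EP) ∞ (fun p => (A p).inverse) p₀ := by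
    have := key p₀ hb.self_of_nhds
    have h1 : ContDiffAt ℝ ∞ (ContinuousLinearMap.inverse : (EP →L[ℝ] 𝔤) → _) (A p₀) := by
      rw [this]; exact contDiffAt_map_inverse _
    exact h1.contMDiffAt.comp p₀ hA
  have := hinv.clm_apply (smooth σ p₀)
  refine this.congr_of_eventuallyEq ?_
  filter_upwards [hb] with p hp
  rw [key p hp, ContinuousLinearMap.inverse_equiv]
  simp [he]

/-- The vector field `X_σ` on `P` with `ω(X_σ) = σ`. -/
def vf (σ : 𝒢.Sections) : SmoothVF EP P := ⟨fun p => (𝒢.form p).symm (σ.1 p), smooth_vf σ⟩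

theorem form_vf (σ : 𝒢.Sections) (p : P) : 𝒢.form p (vf σ p) = σ.1 p :=
  (𝒢.form p).apply_symm_apply _

theorem contMDiff_form_apply (U : SmoothVF EP P) :
    ContMDiff 𝓘(ℝ, EP) 𝓘(ℝ, 𝔤) ∞ fun p => 𝒢.form p (U p) := by
  have h := 𝒢.form_smooth.clm_bundle_apply (v := fun p => U p) (b := fun p => p) U.contMDiff
  intro p
  have := (contMDiffAt_totalSpace.1 (h p)).2
  simpa using this

theorem mdifferentiableAt_form_apply {X : ∀ p : P, TangentSpace 𝓘(ℝ, EP) p} {p : P}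
    (hX : MDifferentiableAt 𝓘(ℝ, EP) (𝓘(ℝ, EP).prod 𝓘(ℝ, EP))
      (fun q => (TotalSpace.mk' EP q (X q) : TangentBundle 𝓘(ℝ, EP) P)) p) :
    MDifferentiableAt 𝓘(ℝ, EP) 𝓘(ℝ, 𝔤) (fun p => 𝒢.form p (X p)) p := by
  have h := ((𝒢.form_smooth p).mdifferentiableAt (by simp)).clm_bundle_apply
    (v := fun p => X p) (b := fun p => p) hX
  have := (mdifferentiableAt_totalSpace _ _).1 h |>.2
  simpa using this

/-! #### The right action and invariance -/

theorem contMDiff_act (𝒢 : CartanGeometry 𝔪 EP P EM M) (h : H) :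
    ContMDiff 𝓘(ℝ, EP) 𝓘(ℝ, EP) ∞ fun q : P => op h • q :=
  𝒢.isPrincipal.smooth_act.comp (contMDiff_id.prodMk contMDiff_const)

theorem Ad_inv_left (𝔪 : CartanModel EH H 𝔤) (h : H) (x : 𝔤) : 𝔪.Ad h (𝔪.Ad h⁻¹ x) = x := by
  rw [← Module.End.mul_apply, ← map_mul]; simp

theorem vf_act (σ : 𝒢.Sections) (h : H) (p : P) :
    mfderiv 𝓘(ℝ, EP) 𝓘(ℝ, EP) (fun q : P => op h • q) p (vf σ p) = vf σ (op h • p) := by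
  apply (𝒢.form (op h • p)).injective
  rw [𝒢.form_act, form_vf, form_vf, act]

/-- The differential of the right translation by `h`, as an isomorphism. -/
def actEquiv (𝒢 : CartanGeometry 𝔪 EP P EM M) (h : H) (p : P) :
    TangentSpace 𝓘(ℝ, EP) p ≃L[ℝ] TangentSpace 𝓘(ℝ, EP) (op h • p) :=
  ((𝒢.form p).trans (LinearEquiv.ofLinearMap (𝔪.Ad h⁻¹) (𝔪.Ad h)
    (by ext x; simp)
    (by ext x; simp)).toContinuousLinearEquiv).trans
      (𝒢.form (op h • p)).symm

theorem mfderiv_act (𝒢 : CartanGeometry 𝔪 EP P EM M) (h : H) (p : P) :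
    mfderiv 𝓘(ℝ, EP) 𝓘(ℝ, EP) (fun q : P => op h • q) p = actEquiv 𝒢 h p := by
  ext v
  apply (𝒢.form (op h • p)).injective
  rw [𝒢.form_act]
  simp [actEquiv]

theorem mpullback_vf (σ : 𝒢.Sections) (h : H) :
    mpullback 𝓘(ℝ, EP) 𝓘(ℝ, EP) (fun q : P => op h • q) (vf σ) = vf σ := by
  funext p
  rw [mpullback_apply, ← vf_act, mfderiv_act 𝒢, ContinuousLinearMap.inverse_equiv]
  simp

theorem bracket_act (σ τ : 𝒢.Sections) (h : H) (p : P) :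
    mfderiv 𝓘(ℝ, EP) 𝓘(ℝ, EP) (fun q : P => op h • q) p (SmoothVF.bracket (vf σ) (vf τ) p) =
      SmoothVF.bracket (vf σ) (vf τ) (op h • p) := by
  have key := mpullback_mlieBracket (𝕜 := ℝ) (I := 𝓘(ℝ, EP)) (I' := 𝓘(ℝ, EP)) (n := ∞)
    (f := fun q : P => op h • q) (x₀ := p)
    (vf σ).mdifferentiableAt (vf τ).mdifferentiableAt (contMDiff_act 𝒢 h p)
    (by rw [minSmoothness_of_isRCLikeNormedField]; exact ENat.LEInfty.out)
  rw [mpullback_vf, mpullback_vf, mpullback_apply, mfderiv_act 𝒢,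
    ContinuousLinearMap.inverse_equiv] at key
  change _ = mlieBracket 𝓘(ℝ, EP) (vf σ) (vf τ) (op h • p)
  rw [mfderiv_act 𝒢]
  change actEquiv 𝒢 h p (mlieBracket 𝓘(ℝ, EP) (vf σ) (vf τ) p) = _
  rw [← key]
  simp

/-! #### The Lie algebroid bracket, the self-representation and the anchor -/

/-- The algebroid bracket `⟦σ, τ⟧ = ω([X_σ, X_τ])`. -/
def algBr (σ τ : 𝒢.Sections) : 𝒢.Sections :=
  ⟨fun p => 𝒢.form p (SmoothVF.bracket (vf σ) (vf τ) p), contMDiff_form_apply _,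
    fun h p => by dsimp only; rw [← bracket_act, 𝒢.form_act]⟩

/-- The fundamental self-representation `D_σ τ = X_σ(τ)`. -/
def D (σ τ : 𝒢.Sections) : 𝒢.Sections :=
  ⟨fun p => mvfderiv 𝓘(ℝ, EP) τ.1 p (vf σ p), contMDiff_mvfderiv_apply (smooth τ) _, by
    intro h p
    have hτ : ∀ p, MDifferentiableAt 𝓘(ℝ, EP) 𝓘(ℝ, 𝔤) τ.1 p :=
      fun p => (smooth τ p).mdifferentiableAt (by simp)
    have h1 := mfderiv_comp p (hτ (op h • p)) ((contMDiff_act 𝒢 h p).mdifferentiableAt (by simp))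
    have h2 : τ.1 ∘ (fun q : P => op h • q) =
        (LinearMap.toContinuousLinearMap (𝔪.Ad h⁻¹)) ∘ τ.1 := by
      ext q; exact act τ h q
    have h3 := mfderiv_comp p
      (LinearMap.toContinuousLinearMap (𝔪.Ad h⁻¹)).mdifferentiableAt (hτ p)
    rw [ContinuousLinearMap.mfderiv_eq] at h3
    have h4 : (mfderiv 𝓘(ℝ, EP) 𝓘(ℝ, 𝔤) (τ.1 ∘ fun q : P => op h • q) p (vf σ p) : 𝔤) =
        mfderiv 𝓘(ℝ, EP) 𝓘(ℝ, 𝔤) (LinearMap.toContinuousLinearMap (𝔪.Ad h⁻¹) ∘ τ.1) p (vf σ p) :=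
      congrArg (fun f : P → 𝔤 => (mfderiv 𝓘(ℝ, EP) 𝓘(ℝ, 𝔤) f p (vf σ p) : 𝔤)) h2
    dsimp only
    rw [← vf_act]
    exact ((congrArg (fun L => L (vf σ p)) h1).symm.trans h4).trans
      (congrArg (fun L => L (vf σ p)) h3)⟩

theorem exists_proj_eq (𝒢 : CartanGeometry 𝔪 EP P EM M) (x : M) : ∃ p, 𝒢.proj p = x := by
  obtain ⟨e, hx, -⟩ := 𝒢.isPrincipal.exists_trivialization x
  exact ⟨e.toOpenPartialHomeomorph.symm (x, 1), e.proj_symm_apply' hx⟩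

theorem exists_act_eq (𝒢 : CartanGeometry 𝔪 EP P EM M) {p q : P} (hpq : 𝒢.proj p = 𝒢.proj q) :
    ∃ h : H, op h • p = q := by
  obtain ⟨e, hx, -, -, he⟩ := 𝒢.isPrincipal.exists_trivialization (𝒢.proj p)
  have hp : p ∈ e.source := e.mem_source.2 hx
  have hq : q ∈ e.source := e.mem_source.2 (hpq ▸ hx)
  refine ⟨(e p).2⁻¹ * (e q).2, ?_⟩
  have hs : op ((e p).2⁻¹ * (e q).2) • p ∈ e.source :=
    e.mem_source.2 (by rwa [𝒢.isPrincipal.proj_act])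
  apply e.injOn hs hq
  change e _ = e q
  rw [he p hp]
  ext
  · simp [e.coe_fst hp, e.coe_fst hq, hpq]
  · simp

/-- The push-forward to `M` of the invariant vector field `X_σ`. By `anchorFun_proj` its value at
`x` can be computed at any point of `P` above `x`. -/
def anchorFun (σ : 𝒢.Sections) (x : M) : TangentSpace 𝓘(ℝ, EM) x :=
  mfderiv 𝓘(ℝ, EP) 𝓘(ℝ, EM) 𝒢.proj (exists_proj_eq 𝒢 x).choose
    (vf σ (exists_proj_eq 𝒢 x).choose)

theorem anchorFun_proj (σ : 𝒢.Sections) (p : P) :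
    anchorFun σ (𝒢.proj p) = mfderiv 𝓘(ℝ, EP) 𝓘(ℝ, EM) 𝒢.proj p (vf σ p) := by
  unfold anchorFun
  have hq := (exists_proj_eq 𝒢 (𝒢.proj p)).choose_spec
  generalize (exists_proj_eq 𝒢 (𝒢.proj p)).choose = q at hq
  obtain ⟨h, rfl⟩ := exists_act_eq 𝒢 hq.symm
  rw [← vf_act]
  have hπ : ∀ p, MDifferentiableAt 𝓘(ℝ, EP) 𝓘(ℝ, EM) 𝒢.proj p :=
    fun p => (𝒢.isPrincipal.smooth_proj p).mdifferentiableAt (by simp)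
  have h1 := mfderiv_comp p (hπ (op h • p)) ((contMDiff_act 𝒢 h p).mdifferentiableAt (by simp))
  have h2 : 𝒢.proj ∘ (fun q : P => op h • q) = 𝒢.proj := by
    ext q; exact 𝒢.isPrincipal.proj_act h q
  rw [h2] at h1
  exact (congrArg (fun L => L (vf σ p)) h1).symm

theorem smooth_anchorFun (σ : 𝒢.Sections) : ContMDiff 𝓘(ℝ, EM) (𝓘(ℝ, EM).prod 𝓘(ℝ, EM)) ∞
    fun x => (TotalSpace.mk' EM x (anchorFun σ x) : TangentBundle 𝓘(ℝ, EM) M) := by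
  intro x₀
  obtain ⟨e, hx, -, hs, -⟩ := 𝒢.isPrincipal.exists_trivialization x₀
  have hb : e.baseSet ∈ nhds x₀ := e.open_baseSet.mem_nhds hx
  let s : M → P := fun x => e.toOpenPartialHomeomorph.symm (x, 1)
  have hs' : ContMDiffAt 𝓘(ℝ, EM) 𝓘(ℝ, EP) ∞ s x₀ := by
    have h0 : (x₀, (1 : H)) ∈ e.target := by simpa [e.target_eq] using hx
    have h1 := (hs _ h0).contMDiffAt (e.open_target.mem_nhds h0)
    exact h1.comp x₀ (contMDiffAt_id.prodMk contMDiffAt_const)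
  have h2 := ((𝒢.isPrincipal.smooth_proj.contMDiff_tangentMap (m := ∞) (by simp)).comp
    (vf σ).contMDiff).contMDiffAt.comp x₀ hs'
  refine h2.congr_of_eventuallyEq ?_
  filter_upwards [hb] with x hxb
  have hsx : 𝒢.proj (s x) = x := e.proj_symm_apply' hxb
  have := congrArg (fun y => (TotalSpace.mk' EM y (anchorFun σ y) : TangentBundle 𝓘(ℝ, EM) M)) hsx
  refine this.symm.trans ?_
  simp only [anchorFun_proj]
  rfl

/-- The anchor `Π : σ ↦ π_* X_σ`. -/
def anchor (σ : 𝒢.Sections) : SmoothVF EM M := ⟨anchorFun σ, smooth_anchorFun σ⟩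

theorem anchor_proj (σ : 𝒢.Sections) (p : P) :
    anchor σ (𝒢.proj p) = mfderiv 𝓘(ℝ, EP) 𝓘(ℝ, EM) 𝒢.proj p (vf σ p) := anchorFun_proj σ p

/-! #### The curvature -/

section Curvature

variable (𝒢)

/-- `X(ω(Y)) - Y(ω(X)) - ω([X, Y])`, for vector fields `X`, `Y` on `P`, at a point `p`. -/
def dformAux (X Y : ∀ p : P, TangentSpace 𝓘(ℝ, EP) p) (p : P) : 𝔤 :=
  mvfderiv 𝓘(ℝ, EP) (fun q => 𝒢.form q (Y q)) p (X p) -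
    mvfderiv 𝓘(ℝ, EP) (fun q => 𝒢.form q (X q)) p (Y p) - 𝒢.form p (mlieBracket 𝓘(ℝ, EP) X Y p)

theorem dformAux_swap (X Y : ∀ p : P, TangentSpace 𝓘(ℝ, EP) p) (p : P) :
    dformAux 𝒢 X Y p = - dformAux 𝒢 Y X p := by
  unfold dformAux
  rw [mlieBracket_swap_apply, map_neg]
  abel

theorem dformAux_tensorial (Y : ∀ p : P, TangentSpace 𝓘(ℝ, EP) p) (p : P)
    (hY : MDifferentiableAt 𝓘(ℝ, EP) (𝓘(ℝ, EP).prod 𝓘(ℝ, EP))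
      (fun q => (TotalSpace.mk' EP q (Y q) : TangentBundle 𝓘(ℝ, EP) P)) p) :
    TensorialAt 𝓘(ℝ, EP) EP (fun X => dformAux 𝒢 X Y p) p where
  smul {f X} hf hX := by
    have h1 : (fun q => 𝒢.form q ((f • X) q)) = f • fun q => 𝒢.form q (X q) := by
      funext q; simp
    simp only [dformAux]
    rw [h1, mvfderiv_smul hf (mdifferentiableAt_form_apply hX), mlieBracket_smul_left hf hX]
    simp
    module
  add {X X'} hX hX' := by
    have h1 : (fun q => 𝒢.form q ((X + X') q)) =
        (fun q => 𝒢.form q (X q)) + fun q => 𝒢.form q (X' q) := by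
      funext q; simp
    simp only [dformAux]
    rw [h1, mvfderiv_add (mdifferentiableAt_form_apply hX) (mdifferentiableAt_form_apply hX'),
      mlieBracket_add_left hX hX']
    simp
    module

/-- The exterior derivative `dω` at `p`, as a bilinear map on `T_p P`. It is characterized by
`dform_apply`. -/
def dform (p : P) : TangentSpace 𝓘(ℝ, EP) p →L[ℝ] TangentSpace 𝓘(ℝ, EP) p →L[ℝ] 𝔤 :=
  TensorialAt.mkHom₂ (dformAux 𝒢 · · p) p
    (fun Y hY => dformAux_tensorial 𝒢 Y p hY)
    (fun X hX => by
      have h := dformAux_tensorial 𝒢 X p hX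
      exact ⟨fun hf hY => by
          rw [dformAux_swap, dformAux_swap 𝒢 X, h.smul hf hY, smul_neg],
        fun hY hY' => by
          rw [dformAux_swap, dformAux_swap 𝒢 X, dformAux_swap 𝒢 X, h.add hY hY', neg_add]⟩)

/-- `dω(X, Y) = X(ω(Y)) - Y(ω(X)) - ω([X, Y])` for smooth vector fields `X`, `Y`. -/
theorem dform_apply (X Y : SmoothVF EP P) (p : P) :
    dform 𝒢 p (X p) (Y p) = mvfderiv 𝓘(ℝ, EP) (fun q => 𝒢.form q (Y q)) p (X p) -
      mvfderiv 𝓘(ℝ, EP) (fun q => 𝒢.form q (X q)) p (Y p) - 𝒢.form p (SmoothVF.bracket X Y p) :=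
  TensorialAt.mkHom₂_apply _ _ X.mdifferentiableAt Y.mdifferentiableAt

/-- The curvature `Ω = dω + {ω, ω}` of the Cartan connection form. -/
def curvature (p : P) (u v : TangentSpace 𝓘(ℝ, EP) p) : 𝔤 :=
  dform 𝒢 p u v + ⁅𝒢.form p u, 𝒢.form p v⁆

/-- `κ` is the curvature regarded as a two-form on `M` with values in the adjoint tractor bundle:
the value of `κ(U, V)` at `p` is `Ω(u, v)` for all tangent vectors `u`, `v` at `p` which project to
the values of `U`, `V` at the point of `M` below `p`. -/
def IsCurvatureForm (κ : SmoothVF EM M → SmoothVF EM M → 𝒢.Sections) : Prop :=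
  ∀ (U V : SmoothVF EM M) (p : P) (u v : TangentSpace 𝓘(ℝ, EP) p),
    mfderiv 𝓘(ℝ, EP) 𝓘(ℝ, EM) 𝒢.proj p u = U (𝒢.proj p) →
    mfderiv 𝓘(ℝ, EP) 𝓘(ℝ, EM) 𝒢.proj p v = V (𝒢.proj p) →
    (κ U V : P → 𝔤) p = curvature 𝒢 p u v

/-- `nabla` is the tractor connection: `∇ᵀ_U σ = D_ρ σ + {ρ, σ}` for any `ρ` with `Π(ρ) = U`. -/
def IsTractorConnection (nabla : SmoothVF EM M → 𝒢.Sections → 𝒢.Sections) : Prop :=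
  ∀ (U : SmoothVF EM M) (ρ : 𝒢.Sections), anchor ρ = U →
    ∀ σ, nabla U σ = D ρ σ + lieBr ρ σ

/-- `nabla` is Blaom's Cartan connection: `∇ᶜ_U σ = D_σ ρ - ⟦σ, ρ⟧` for any `ρ` with
`Π(ρ) = U`. -/
def IsBlaomConnection (nabla : SmoothVF EM M → 𝒢.Sections → 𝒢.Sections) : Prop :=
  ∀ (U : SmoothVF EM M) (ρ : 𝒢.Sections), anchor ρ = U →
    ∀ σ, nabla U σ = D σ ρ - algBr σ ρ

end Curvature

end CartanGeometry

end Cartan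

/-! ### Lie algebroids and their connections, in terms of sections -/

section Algebroids

variable {EM M : Type*} [NormedAddCommGroup EM] [NormedSpace ℝ EM] [CompleteSpace EM]
  [TopologicalSpace M] [ChartedSpace EM M] [IsManifold 𝓘(ℝ, EM) ∞ M]
  {A S : Type*} [AddCommGroup A] [Module ℝ A] [SMul (SmoothFn EM M) A]
  [AddCommGroup S] [Module ℝ S] [SMul (SmoothFn EM M) S]

/-- The axioms of a Lie algebroid over `M`, on the space `A` of sections of the underlying vector
bundle, with anchor `anchor` and bracket `br`. -/
structure IsLieAlgebroid (anchor : A → SmoothVF EM M) (br : A → A → A) : Prop where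
  anchor_add : ∀ σ τ, anchor (σ + τ) = anchor σ + anchor τ
  anchor_smul : ∀ (f : SmoothFn EM M) σ, anchor (f • σ) = f • anchor σ
  skew : ∀ σ τ, br σ τ = - br τ σ
  add_right : ∀ σ τ τ', br σ (τ + τ') = br σ τ + br σ τ'
  smul_right : ∀ (c : ℝ) σ τ, br σ (c • τ) = c • br σ τ
  leibniz : ∀ (f : SmoothFn EM M) σ τ, br σ (f • τ) = f • br σ τ + (anchor σ).deriv f • τ
  jacobi : ∀ ρ σ τ, br ρ (br σ τ) = br (br ρ σ) τ + br σ (br ρ τ)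
  anchor_br : ∀ σ τ, anchor (br σ τ) = SmoothVF.bracket (anchor σ) (anchor τ)

/-- `D` is an `A`-connection on a vector bundle with space of sections `S`, where `A` is the space
of sections of a Lie algebroid with anchor `anchor`. For the tangent algebroid, where `A` is the
space of vector fields and `anchor` is the identity, these are the linear connections. -/
structure IsAlgebroidConnection (anchor : A → SmoothVF EM M) (D : A → S → S) : Prop where
  add_left : ∀ σ τ ε, D (σ + τ) ε = D σ ε + D τ ε
  smul_left : ∀ (c : ℝ) σ ε, D (c • σ) ε = c • D σ ε
  fn_smul_left : ∀ (f : SmoothFn EM M) σ ε, D (f • σ) ε = f • D σ ε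
  add_right : ∀ σ ε ε', D σ (ε + ε') = D σ ε + D σ ε'
  smul_right : ∀ (c : ℝ) σ ε, D σ (c • ε) = c • D σ ε
  leibniz : ∀ (f : SmoothFn EM M) σ ε, D σ (f • ε) = f • D σ ε + (anchor σ).deriv f • ε

/-- A representation of a Lie algebroid: an `A`-connection whose curvature vanishes. -/
structure IsAlgebroidRepresentation (anchor : A → SmoothVF EM M) (br : A → A → A)
    (D : A → S → S) : Prop extends IsAlgebroidConnection anchor D where
  flat : ∀ σ τ ε, D (br σ τ) ε = D σ (D τ ε) - D τ (D σ ε)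

/-- A linear connection (covariant derivative) on a vector bundle with space of sections `S`. -/
abbrev IsLinearConnection (nabla : SmoothVF EM M → S → S) : Prop :=
  IsAlgebroidConnection (fun U : SmoothVF EM M => U) nabla

/-- The operator `∇^*_σ U = Π(∇_U σ) + [Π(σ), U]` on vector fields associated with a linear
connection `∇` on a Lie algebroid. -/
def dualOnVF (anchor : A → SmoothVF EM M) (nabla : SmoothVF EM M → A → A) (σ : A)
    (U : SmoothVF EM M) : SmoothVF EM M :=
  anchor (nabla U σ) + SmoothVF.bracket (anchor σ) U

/-- Blaom's condition of compatibility of a linear connection `∇` on a Lie algebroid with the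
bracket of the algebroid. -/
def IsCompatibleWithBracket (anchor : A → SmoothVF EM M) (br : A → A → A)
    (nabla : SmoothVF EM M → A → A) : Prop :=
  ∀ (U : SmoothVF EM M) (σ τ : A),
    nabla U (br σ τ) = br (nabla U σ) τ + br σ (nabla U τ) +
      nabla (dualOnVF anchor nabla τ U) σ - nabla (dualOnVF anchor nabla σ U) τ

end Algebroids

end

/-! The form `ω` identifies sections with `H`-invariant vector fields on `P`, so the algebroid is a
Lie algebra of vector fields in disguise. The Leibniz rule and the Jacobi identity are those of the
Lie bracket on `P`. Flatness of `D` is the formula `[X, Y]f = X(Yf) - Y(Xf)`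
(`mvfderiv_mlieBracket`). The anchor respects brackets because `X_σ` is related to `Π(σ)` by the
projection (`mfderiv_mlieBracket_of_related`).

Descent to `M` rests on the behaviour along the fibres, where every vertical vector is the value of
a fundamental field. Differentiating equivariance gives `u(σ) = -{ω(u), σ}` for vertical `u`
(`mvfderiv_of_vertical`), so `D_ρ σ + {ρ, σ}` depends on `ρ` only through `Π(ρ)`. Invariant fields
commute with fundamental ones and `ω(ξ̃)` is constant, so the curvature vanishes on vertical vectors
(`curvature_vertical_vf`). Sections with prescribed values and lifts of vector fields are glued by a
partition of unity on `M`; only there is `M` required to be Hausdorff and second countable.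

On `X_ρ`, `X_σ` the curvature is `D_ρ σ - D_σ ρ - ⟦ρ, σ⟧ + {ρ, σ}`. Rearranged (`blaom_eq`), this
says that Blaom's expression is the tractor expression minus curvature. Hence it too depends only on
`Π(ρ)`, and the two connections differ by `κ`. For compatibility, `∇^*_σ Π(ρ) = Π(D_σ ρ)`; with the
lift `D_σ ρ` the identity reduces to flatness of `D` and the Jacobi identity. -/

/-! ### Brackets as commutators of derivations, and related vector fields. -/

section RelatedFields

variable {E B N F : Type*} [NormedAddCommGroup E] [NormedSpace ℝ E] [CompleteSpace E]
  [TopologicalSpace B] {I : ModelWithCorners ℝ E B} [I.Boundaryless]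
  [TopologicalSpace N] [ChartedSpace B N] [IsManifold I ∞ N]
  [NormedAddCommGroup F] [NormedSpace ℝ F]

/-- The derivative along the bracket of two vector fields is the commutator of the derivatives. -/
theorem mvfderiv_mlieBracket {f : N → F} {V W : ∀ x : N, TangentSpace I x} {x : N}
    (hf : ContMDiffAt I 𝓘(ℝ, F) ∞ f x)
    (hV : MDifferentiableAt I I.tangent (fun y => (⟨y, V y⟩ : TangentBundle I N)) x)
    (hW : MDifferentiableAt I I.tangent (fun y => (⟨y, W y⟩ : TangentBundle I N)) x) :
    mvfderiv I f x (mlieBracket I V W x) =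
      mvfderiv I (fun y => mvfderiv I f y (W y)) x (V x) -
        mvfderiv I (fun y => mvfderiv I f y (V y)) x (W x) := by
  have h2 : IsManifold I 2 N := IsManifold.of_le (n := ∞) (by exact ENat.LEInfty.out)
  have h1 : IsManifold I 1 N := IsManifold.of_le (n := ∞) (by exact ENat.LEInfty.out)
  set φ := extChartAt I x with hφ
  set g : E → F := f ∘ φ.symm with hg
  have hgx : ContDiffAt ℝ 2 g (φ x) := by
    have := (contMDiffAt_iff.1 hf).2
    simp only [I.range_eq_univ, contDiffWithinAt_univ] at this
    exact this.of_le (by exact ENat.LEInfty.out)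
  have hdiff : ∀ {V : ∀ x : N, TangentSpace I x},
      MDifferentiableAt I I.tangent (fun y => (⟨y, V y⟩ : TangentBundle I N)) x →
      DifferentiableAt ℝ (mpullbackWithin 𝓘(ℝ, E) I φ.symm V (range I)) (φ x) := by
    intro V hV
    have := (mdifferentiableWithinAt_univ.2 hV).differentiableWithinAt_mpullbackWithin_vectorField
    simp only [I.range_eq_univ, preimage_univ, inter_univ] at this ⊢
    exact differentiableWithinAt_univ.1 this
  -- The derivative of the chart undoes the pullback by its inverse. This holds only near `x`, which
  -- is all that a derivative at `x` sees.
  have hpush : ∀ V : ∀ x : N, TangentSpace I x, ∀ᶠ z in nhds x,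
      mfderiv I 𝓘(ℝ, E) φ z (V z) = mpullbackWithin 𝓘(ℝ, E) I φ.symm V (range I) (φ z) := by
    intro V
    have h3 := eventuallyEq_mpullback_mpullbackWithin_extChartAt (s := univ) (x := x) V
    rw [nhdsWithin_univ] at h3
    filter_upwards [h3, extChartAt_source_mem_nhds (I := I) x] with z hz hzs
    have hinv := isInvertible_mfderiv_extChartAt (I := I) hzs
    conv_lhs => rw [hz, mpullback_apply]
    obtain ⟨A, hA⟩ := hinv
    rw [← hA, ContinuousLinearMap.inverse_equiv]
    exact A.apply_symm_apply _
  have hmd : ∀ᶠ z in nhds x, ∀ v : TangentSpace I z,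
      mvfderiv I f z v = fderiv ℝ g (φ z) (mfderiv I 𝓘(ℝ, E) φ z v) := by
    have hgd : ∀ᶠ y in nhds (φ x), DifferentiableAt ℝ g y := by
      filter_upwards [hgx.eventually (by simp)] with y hy
      exact hy.differentiableAt (by simp)
    filter_upwards [(continuousAt_extChartAt (I := I) x).eventually hgd,
      (isOpen_extChartAt_source (I := I) x).mem_nhds (mem_extChartAt_source x)] with z hz hzs v
    have heq : f =ᶠ[nhds z] g ∘ φ := by
      filter_upwards [(isOpen_extChartAt_source (I := I) x).mem_nhds hzs] with w hw
      simp only [hg, comp_apply]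
      rw [φ.left_inv hw]
    have h4 := mfderiv_comp_apply z hz.mdifferentiableAt
      (mdifferentiableAt_extChartAt (by simpa using hzs)) v
    rw [mfderiv_eq_fderiv] at h4
    refine Eq.trans ?_ h4
    rw [← heq.mfderiv_eq]
    rfl
  -- Iterated derivatives can thus be computed in the chart. The outer field enters only through its
  -- value at `x`, so only `W` must be differentiable.
  have hpair : ∀ {V W : ∀ x : N, TangentSpace I x},
      MDifferentiableAt I I.tangent (fun y => (⟨y, W y⟩ : TangentBundle I N)) x →
      mvfderiv I (fun y => mvfderiv I f y (W y)) x (V x) =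
      fderiv ℝ (fun y => fderiv ℝ g y (mpullbackWithin 𝓘(ℝ, E) I φ.symm W (range I) y)) (φ x)
        (mpullbackWithin 𝓘(ℝ, E) I φ.symm V (range I) (φ x)) := by
    intro V W hW
    set G : E → F := fun y => fderiv ℝ g y (mpullbackWithin 𝓘(ℝ, E) I φ.symm W (range I) y)
    have hG : DifferentiableAt ℝ G (φ x) :=
      ((hgx.fderiv_right (m := 1) (by norm_num)).differentiableAt (by simp)).clm_apply (hdiff hW)
    have heq : (fun y => mvfderiv I f y (W y)) =ᶠ[nhds x] G ∘ φ := by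
      filter_upwards [hmd, hpush W] with z h5 h6
      rw [h5, h6]; rfl
    have h4 := mfderiv_comp_apply x hG.mdifferentiableAt
      (mdifferentiableAt_extChartAt (by simp)) (V x)
    rw [mfderiv_eq_fderiv] at h4
    rw [← (hpush V).self_of_nhds]
    refine Eq.trans ?_ h4
    rw [← heq.mfderiv_eq]
    rfl
  -- In the model space the identity rests on the symmetry of the second derivative of `g`.
  rw [hpair hW, hpair hV, ← fderiv_apply_lieBracket hgx (by simp) (hdiff hW) (hdiff hV),
    hmd.self_of_nhds]
  congr 1
  rw [mlieBracket, mlieBracketWithin_apply]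
  obtain ⟨A, hA⟩ := isInvertible_mfderiv_extChartAt (I := I) (mem_extChartAt_source (I := I) x)
  rw [← hφ] at hA ⊢
  rw [← hA, ContinuousLinearMap.inverse_equiv]
  refine (A.apply_symm_apply _).trans ?_
  simp only [I.range_eq_univ, preimage_univ, inter_univ]
  exact congrFun (lieBracketWithin_univ (E := E)) _

/-- The derivative of a smooth function along a differentiable vector field is differentiable. -/
theorem mdifferentiableAt_mvfderiv_apply {f : N → F} {V : ∀ x : N, TangentSpace I x} {x : N}
    (hf : ContMDiffAt I 𝓘(ℝ, F) ∞ f x)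
    (hV : MDifferentiableAt I I.tangent (fun y => (⟨y, V y⟩ : TangentBundle I N)) x) :
    MDifferentiableAt I 𝓘(ℝ, F) (fun y => mvfderiv I f y (V y)) x := by
  have h1 : IsManifold I 1 N := IsManifold.of_le (n := ∞) (by exact ENat.LEInfty.out)
  have h := (hf.mfderiv_const (m := 1) (by rw [one_add_one_eq_two]; exact ENat.LEInfty.out)).mdifferentiableAt (by simp)
  have h3 := MDifferentiableAt.clm_apply_of_inCoordinates (b₁ := id) (b₂ := f)
    (ϕ := fun y => mfderiv I 𝓘(ℝ, F) f y) (v := V) h hV (hf.mdifferentiableAt (by simp))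
  exact ((contMDiff_snd_tangentBundle_modelSpace (𝕜 := ℝ) F 𝓘(ℝ, F)).contMDiffAt.mdifferentiableAt
    one_ne_zero).comp x h3

variable {E' B' N' : Type*} [NormedAddCommGroup E'] [NormedSpace ℝ E'] [CompleteSpace E']
  [TopologicalSpace B'] {I' : ModelWithCorners ℝ E' B'} [I'.Boundaryless]
  [TopologicalSpace N'] [ChartedSpace B' N'] [IsManifold I' ∞ N']

/-- If `V`, `W` are related to `X`, `Y` by a smooth map, then so are their brackets. -/
theorem mfderiv_mlieBracket_of_related {f : N → N'} {V W : ∀ x : N, TangentSpace I x}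
    {X Y : ∀ y : N', TangentSpace I' y} {x : N} (hf : ContMDiff I I' ∞ f)
    (hV : MDifferentiableAt I I.tangent (fun y => (⟨y, V y⟩ : TangentBundle I N)) x)
    (hW : MDifferentiableAt I I.tangent (fun y => (⟨y, W y⟩ : TangentBundle I N)) x)
    (hX : MDifferentiableAt I' I'.tangent (fun y => (⟨y, X y⟩ : TangentBundle I' N')) (f x))
    (hY : MDifferentiableAt I' I'.tangent (fun y => (⟨y, Y y⟩ : TangentBundle I' N')) (f x))
    (hVX : ∀ y, mfderiv I I' f y (V y) = X (f y)) (hWY : ∀ y, mfderiv I I' f y (W y) = Y (f y)) :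
    mfderiv I I' f x (mlieBracket I V W x) = mlieBracket I' X Y (f x) := by
  have h1 : IsManifold I' 1 N' := IsManifold.of_le (n := ∞) (by exact ENat.LEInfty.out)
  -- The chart at `f x` serves as a vector-valued test function: its derivative `A` there is
  -- invertible, so it suffices to compare images under `A`.
  set φ := extChartAt I' (f x) with hφ
  have hφs : ContMDiffAt I' 𝓘(ℝ, E') ∞ φ (f x) := contMDiffAt_extChartAt
  obtain ⟨A, hA⟩ := isInvertible_mfderiv_extChartAt (I := I') (mem_extChartAt_source (I := I') (f x))
  apply A.injective
  have hfd := hf.mdifferentiable (by simp) x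
  have hpair : ∀ {V W : ∀ x : N, TangentSpace I x} {X Y : ∀ y : N', TangentSpace I' y},
      MDifferentiableAt I' I'.tangent (fun y => (⟨y, Y y⟩ : TangentBundle I' N')) (f x) →
      (∀ y, mfderiv I I' f y (V y) = X (f y)) → (∀ y, mfderiv I I' f y (W y) = Y (f y)) →
      mvfderiv I (fun y => mvfderiv I (φ ∘ f) y (W y)) x (V x) =
        mvfderiv I' (fun y => mvfderiv I' φ y (Y y)) (f x) (X (f x)) := by
    intro V W X Y hY hV hW
    have heq : (fun y => mvfderiv I (φ ∘ f) y (W y)) =ᶠ[nhds x]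
        (fun y => mvfderiv I' φ y (Y y)) ∘ f := by
      filter_upwards [hf.continuous.continuousAt.eventually
        ((isOpen_extChartAt_source (I := I') (f x)).mem_nhds (mem_extChartAt_source (f x)))]
        with y hy
      have := mfderiv_comp_apply y (mdifferentiableAt_extChartAt (by rw [← extChartAt_source I']; exact hy))
        (hf.mdifferentiable (by simp) y) (W y)
      rw [hW] at this
      exact this
    have h4 := mfderiv_comp_apply x (mdifferentiableAt_mvfderiv_apply hφs hY) hfd (V x)
    rw [hV] at h4
    refine Eq.trans ?_ h4
    rw [← heq.mfderiv_eq]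
    rfl
  -- Both brackets become commutators: relatedness turns iterated derivatives of `φ ∘ f` along `V`,
  -- `W` into those of `φ` along `X`, `Y`.
  have h5 := mvfderiv_mlieBracket (hφs.comp x hf.contMDiffAt) hV hW
  rw [hpair hY hVX hWY, hpair hX hWY hVX, ← mvfderiv_mlieBracket hφs hX hY] at h5
  have h6 := mfderiv_comp_apply x (hφs.mdifferentiableAt (by simp)) hfd (mlieBracket I V W x)
  rw [← hφ] at hA
  rw [← hA] at h6
  refine (h6.symm.trans h5).trans ?_
  exact (congrArg (fun L => L (mlieBracket I' X Y (f x))) hA).symm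

end RelatedFields

/-! ### Smooth right actions and their fundamental vector fields. -/

section SmoothAction

variable {EH H EP P : Type*}
  [NormedAddCommGroup EH] [NormedSpace ℝ EH] [CompleteSpace EH]
  [TopologicalSpace H] [ChartedSpace EH H] [Group H] [LieGroup 𝓘(ℝ, EH) ∞ H]
  [NormedAddCommGroup EP] [NormedSpace ℝ EP] [CompleteSpace EP]
  [TopologicalSpace P] [ChartedSpace EP P] [IsManifold 𝓘(ℝ, EP) ∞ P] [MulAction Hᵐᵒᵖ P]

/-- The vector fields on a product which are given by vector fields on the factors are
differentiable. -/
theorem mdifferentiableAt_prod_vectorField {X : ∀ p : P, TangentSpace 𝓘(ℝ, EP) p}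
    {Y : ∀ h : H, TangentSpace 𝓘(ℝ, EH) h} {q : P × H}
    (hX : MDifferentiableAt 𝓘(ℝ, EP) 𝓘(ℝ, EP).tangent
      (fun p => (⟨p, X p⟩ : TangentBundle 𝓘(ℝ, EP) P)) q.1)
    (hY : MDifferentiableAt 𝓘(ℝ, EH) 𝓘(ℝ, EH).tangent
      (fun h => (⟨h, Y h⟩ : TangentBundle 𝓘(ℝ, EH) H)) q.2) :
    MDifferentiableAt (𝓘(ℝ, EP).prod 𝓘(ℝ, EH)) (𝓘(ℝ, EP).prod 𝓘(ℝ, EH)).tangent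
      (fun q => (⟨q, (X q.1, Y q.2)⟩ : TangentBundle (𝓘(ℝ, EP).prod 𝓘(ℝ, EH)) (P × H))) q :=
  (contMDiff_equivTangentBundleProd_symm (n := ∞) (I := 𝓘(ℝ, EP)) (M := P) (I' := 𝓘(ℝ, EH))
    (M' := H) |>.mdifferentiable (by simp) _).comp q
    ((hX.comp q mdifferentiableAt_fst).prodMk (hY.comp q mdifferentiableAt_snd))

/-- The bracket of vector fields on a product coming from different factors vanishes. -/
theorem mlieBracket_prod_eq_zero {X : ∀ p : P, TangentSpace 𝓘(ℝ, EP) p}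
    {Y : ∀ h : H, TangentSpace 𝓘(ℝ, EH) h} {q : P × H}
    (hX : MDifferentiableAt 𝓘(ℝ, EP) 𝓘(ℝ, EP).tangent
      (fun p => (⟨p, X p⟩ : TangentBundle 𝓘(ℝ, EP) P)) q.1)
    (hY : MDifferentiableAt 𝓘(ℝ, EH) 𝓘(ℝ, EH).tangent
      (fun h => (⟨h, Y h⟩ : TangentBundle 𝓘(ℝ, EH) H)) q.2) :
    mlieBracket (𝓘(ℝ, EP).prod 𝓘(ℝ, EH)) (fun q : P × H => ((0, Y q.2) : EP × EH))
      (fun q : P × H => ((X q.1, 0) : EP × EH)) q = 0 := by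
  have z1 : MDifferentiableAt 𝓘(ℝ, EP) 𝓘(ℝ, EP).tangent
      (fun p => (⟨p, 0⟩ : TangentBundle 𝓘(ℝ, EP) P)) q.1 :=
    (contMDiff_zeroSection ℝ (TangentSpace 𝓘(ℝ, EP) (M := P)) (n := ∞)).mdifferentiable
      (by simp) _
  have z2 : MDifferentiableAt 𝓘(ℝ, EH) 𝓘(ℝ, EH).tangent
      (fun h => (⟨h, 0⟩ : TangentBundle 𝓘(ℝ, EH) H)) q.2 :=
    (contMDiff_zeroSection ℝ (TangentSpace 𝓘(ℝ, EH) (M := H)) (n := ∞)).mdifferentiable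
      (by simp) _
  -- The projections relate the first field to `0` and `Y`, the second to `X` and `0`, so each
  -- component of the bracket is a bracket with a zero field.
  have h1 := mfderiv_mlieBracket_of_related (x := q) (contMDiff_fst (n := ∞))
    (mdifferentiableAt_prod_vectorField z1 hY) (mdifferentiableAt_prod_vectorField hX z2)
    (X := 0) (Y := X) z1 hX (fun y => by rw [mfderiv_fst]; rfl) (fun y => by rw [mfderiv_fst]; rfl)
  have h2 := mfderiv_mlieBracket_of_related (x := q) (contMDiff_snd (n := ∞))
    (mdifferentiableAt_prod_vectorField z1 hY) (mdifferentiableAt_prod_vectorField hX z2)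
    (X := Y) (Y := 0) hY z2 (fun y => by rw [mfderiv_snd]; rfl) (fun y => by rw [mfderiv_snd]; rfl)
  rw [mlieBracket_zero_left, mfderiv_fst] at h1
  rw [mlieBracket_zero_right, mfderiv_snd] at h2
  exact Prod.ext h1 h2

variable (P) in
/-- The fundamental vector field of a right action. -/
noncomputable def fundamentalVF (ξ : GroupLieAlgebra 𝓘(ℝ, EH) H) (p : P) : TangentSpace 𝓘(ℝ, EP) p :=
  (mfderiv 𝓘(ℝ, EH) 𝓘(ℝ, EP) (fun h : H => op h • p) 1 ξ : EP)

/-- The derivative of a right action along the group. -/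
theorem mfderiv_act_apply_zero_left
    (hs : ContMDiff (𝓘(ℝ, EP).prod 𝓘(ℝ, EH)) 𝓘(ℝ, EP) ∞ fun q : P × H => op q.2 • q.1)
    (q : P × H) (w : EH) :
    (mfderiv (𝓘(ℝ, EP).prod 𝓘(ℝ, EH)) 𝓘(ℝ, EP) (fun q : P × H => op q.2 • q.1) q
      ((0, w) : EP × EH) : EP) = mfderiv 𝓘(ℝ, EH) 𝓘(ℝ, EP) (fun h : H => op h • q.1) q.2 w := by
  let b : EP := mfderiv 𝓘(ℝ, EH) 𝓘(ℝ, EP) (fun h : H => op h • q.1) q.2 w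
  exact (mfderiv_prod_eq_add_apply (hs.mdifferentiable (by simp) q)).trans
    ((congrArg (fun a : EP => a + b)
      (map_zero (mfderiv 𝓘(ℝ, EP) 𝓘(ℝ, EP) (fun p : P => op q.2 • p) q.1))).trans (zero_add _))

/-- The derivative of a right action along the space. -/
theorem mfderiv_act_apply_zero_right
    (hs : ContMDiff (𝓘(ℝ, EP).prod 𝓘(ℝ, EH)) 𝓘(ℝ, EP) ∞ fun q : P × H => op q.2 • q.1)
    (q : P × H) (v : EP) :
    (mfderiv (𝓘(ℝ, EP).prod 𝓘(ℝ, EH)) 𝓘(ℝ, EP) (fun q : P × H => op q.2 • q.1) q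
      ((v, 0) : EP × EH) : EP) = mfderiv 𝓘(ℝ, EP) 𝓘(ℝ, EP) (fun p : P => op q.2 • p) q.1 v := by
  let b : EP := mfderiv 𝓘(ℝ, EP) 𝓘(ℝ, EP) (fun p : P => op q.2 • p) q.1 v
  exact (mfderiv_prod_eq_add_apply (hs.mdifferentiable (by simp) q)).trans
    ((congrArg (fun a : EP => b + a)
      (map_zero (mfderiv 𝓘(ℝ, EH) 𝓘(ℝ, EP) (fun h : H => op h • q.1) q.2))).trans (add_zero _))

/-- Fundamental vector fields are smooth. -/
theorem contMDiff_fundamentalVF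
    (hs : ContMDiff (𝓘(ℝ, EP).prod 𝓘(ℝ, EH)) 𝓘(ℝ, EP) ∞ fun q : P × H => op q.2 • q.1)
    (ξ : GroupLieAlgebra 𝓘(ℝ, EH) H) : ContMDiff 𝓘(ℝ, EP) 𝓘(ℝ, EP).tangent ∞
      fun p => (⟨p, fundamentalVF P ξ p⟩ : TangentBundle 𝓘(ℝ, EP) P) := by
  have h1 : ContMDiff 𝓘(ℝ, EP) 𝓘(ℝ, EP).tangent ∞
      (fun p => (⟨p, 0⟩ : TangentBundle 𝓘(ℝ, EP) P)) := contMDiff_zeroSection _ _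
  have h2 : ContMDiff 𝓘(ℝ, EP) 𝓘(ℝ, EH).tangent ∞
      (fun p : P => (⟨1, ξ⟩ : TangentBundle 𝓘(ℝ, EH) H)) := contMDiff_const
  have h3 := (hs.contMDiff_tangentMap (m := ∞) (by simp)).comp
    ((contMDiff_equivTangentBundleProd_symm (n := ∞) (I := 𝓘(ℝ, EP)) (M := P) (I' := 𝓘(ℝ, EH))
      (M' := H)).comp (h1.prodMk h2))
  refine h3.congr fun p => ?_
  have h4 := mfderiv_act_apply_zero_left hs (p, 1) ξ
  refine TotalSpace.ext (by simp [tangentMap]) ?_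
  exact heq_of_eq h4.symm

/-- An invariant vector field commutes with fundamental vector fields. -/
theorem mlieBracket_fundamentalVF
    (hs : ContMDiff (𝓘(ℝ, EP).prod 𝓘(ℝ, EH)) 𝓘(ℝ, EP) ∞ fun q : P × H => op q.2 • q.1)
    {X : ∀ p : P, TangentSpace 𝓘(ℝ, EP) p}
    (hX : ContMDiff 𝓘(ℝ, EP) 𝓘(ℝ, EP).tangent ∞ (fun p => (⟨p, X p⟩ : TangentBundle 𝓘(ℝ, EP) P)))
    (hinv : ∀ (h : H) (p : P),
      mfderiv 𝓘(ℝ, EP) 𝓘(ℝ, EP) (fun q : P => op h • q) p (X p) = X (op h • p))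
    (ξ : GroupLieAlgebra 𝓘(ℝ, EH) H) (p : P) :
    mlieBracket 𝓘(ℝ, EP) (fundamentalVF P ξ) X p = 0 := by
  have hξ := mdifferentiable_mulInvariantVectorField ξ
  have hX' := hX.mdifferentiable (by simp)
  have hF := (contMDiff_fundamentalVF hs ξ).mdifferentiable (by simp)
  have z1 : MDifferentiable 𝓘(ℝ, EP) 𝓘(ℝ, EP).tangent
      (fun p => (⟨p, 0⟩ : TangentBundle 𝓘(ℝ, EP) P)) :=
    (contMDiff_zeroSection ℝ (TangentSpace 𝓘(ℝ, EP) (M := P)) (n := ∞)).mdifferentiable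
      (by simp)
  have z2 : MDifferentiable 𝓘(ℝ, EH) 𝓘(ℝ, EH).tangent
      (fun h => (⟨h, 0⟩ : TangentBundle 𝓘(ℝ, EH) H)) :=
    (contMDiff_zeroSection ℝ (TangentSpace 𝓘(ℝ, EH) (M := H)) (n := ∞)).mdifferentiable
      (by simp)
  have hsm : ∀ (q : P), ContMDiff 𝓘(ℝ, EH) 𝓘(ℝ, EP) ∞ fun h : H => op h • q :=
    fun q => hs.comp (contMDiff_const.prodMk contMDiff_id)
  -- The action map `P × H → P` relates the left-invariant field of `ξ` to the fundamental field,
  -- since `(p h) g = p (h g)`, and relates `X` on the factor `P` to `X` itself, by invariance.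
  -- Fields from different factors commute.
  have h := mfderiv_mlieBracket_of_related (x := ((p, 1) : P × H)) hs
    (mdifferentiableAt_prod_vectorField (z1 p) (hξ 1))
    (mdifferentiableAt_prod_vectorField (hX' p) (z2 1)) (X := fundamentalVF P ξ) (Y := X)
    (hF _) (hX' _) (fun y => by
      refine (mfderiv_act_apply_zero_left hs y _).trans ?_
      have h5 := mfderiv_comp_apply (1 : H) (f := fun g : H => y.2 * g)
        (g := fun h : H => op h • y.1) ((hsm y.1).mdifferentiable (by simp) _)
        ((contMDiff_mul_left (I := 𝓘(ℝ, EH)) (n := ∞)).mdifferentiable (by simp) _) ξ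
      have h6 : ((fun h : H => op h • y.1) ∘ fun g : H => y.2 * g) =
          fun g : H => op g • (op y.2 • y.1) := funext fun g => mul_smul (op g) (op y.2) y.1
      rw [h6, mul_one] at h5
      exact h5.symm) (fun y =>
      (mfderiv_act_apply_zero_right hs y _).trans (hinv y.2 y.1))
  have h6 := mlieBracket_prod_eq_zero (q := ((p, 1) : P × H)) (hX' p) (hξ 1)
  rw [op_one, one_smul] at h
  exact h.symm.trans ((congrArg (mfderiv (𝓘(ℝ, EP).prod 𝓘(ℝ, EH)) 𝓘(ℝ, EP)
    (fun q : P × H => op q.2 • q.1) (p, 1)) h6).trans (map_zero _))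

end SmoothAction

/-! ### Derivatives of inversion and left translation. -/

section LieGroup

variable {EH H : Type*} [NormedAddCommGroup EH] [NormedSpace ℝ EH] [CompleteSpace EH]
  [TopologicalSpace H] [ChartedSpace EH H] [Group H] [LieGroup 𝓘(ℝ, EH) ∞ H]

/-- The derivative of the inversion of a Lie group at the identity. -/
theorem mfderiv_inv_one (ξ : EH) :
    (mfderiv 𝓘(ℝ, EH) 𝓘(ℝ, EH) (fun h : H => h⁻¹) 1 ξ : EH) = -ξ := by
  have hm : MDifferentiableAt (𝓘(ℝ, EH).prod 𝓘(ℝ, EH)) 𝓘(ℝ, EH)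
      (fun q : H × H => q.1 * q.2) (1, 1⁻¹) := (contMDiff_mul 𝓘(ℝ, EH) ∞).mdifferentiable (by simp) _
  have hi : MDifferentiableAt 𝓘(ℝ, EH) 𝓘(ℝ, EH) (fun h : H => h⁻¹) 1 :=
    (contMDiff_inv 𝓘(ℝ, EH) ∞).mdifferentiable (by simp) _
  -- Differentiate `h * h⁻¹ = 1` at the identity.
  have h1 := mfderiv_comp_apply (1 : H) (g := fun q : H × H => q.1 * q.2)
    (f := fun h : H => (h, h⁻¹)) hm (mdifferentiableAt_id.prodMk hi) ξ
  have h2 : (fun q : H × H => q.1 * q.2) ∘ (fun h : H => (h, h⁻¹)) = fun _ => 1 := by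
    funext h; simp
  rw [h2, mfderiv_const, mfderiv_prod_eq_add_apply hm,
    mfderiv_prodMk (f := fun h : H => h) mdifferentiableAt_id hi] at h1
  have h3 : ∀ v : EH, (mfderiv 𝓘(ℝ, EH) 𝓘(ℝ, EH) (fun z : H => z * 1⁻¹) 1 v : EH) = v := by
    intro v
    have : (fun z : H => z * 1⁻¹) = id := by funext z; simp
    rw [this, mfderiv_id]; rfl
  have h4 : ∀ v : EH, (mfderiv 𝓘(ℝ, EH) 𝓘(ℝ, EH) (fun z : H => 1 * z) 1⁻¹ v : EH) = v := by
    intro v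
    have : (fun z : H => 1 * z) = id := by funext z; simp
    rw [this, mfderiv_id]; rfl
  have h5 : (mfderiv 𝓘(ℝ, EH) 𝓘(ℝ, EH) (fun h : H => h) 1 ξ : EH) = ξ :=
    congrArg (fun L => L ξ) (mfderiv_id (I := 𝓘(ℝ, EH)) (x := (1 : H)))
  let b : EH := mfderiv 𝓘(ℝ, EH) 𝓘(ℝ, EH) (fun h : H => h⁻¹) 1 ξ
  have h6 : 0 = ξ + b := h1.trans (congrArg₂ (fun a b : EH => a + b) ((h3 _).trans h5) (h4 _))
  exact (neg_eq_of_add_eq_zero_right h6.symm).symm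

/-- The derivative of a left translation at the identity is surjective. -/
theorem surjective_mfderiv_mul_left (g : H) (w : EH) :
    ∃ ξ : EH, (mfderiv 𝓘(ℝ, EH) 𝓘(ℝ, EH) (fun h : H => g * h) 1 ξ : EH) = w := by
  have h1 := mfderiv_comp_apply g (g := fun h : H => g * h) (f := fun h : H => g⁻¹ * h)
    ((contMDiff_mul_left (I := 𝓘(ℝ, EH)) (n := ∞)).mdifferentiable (by simp) _)
    ((contMDiff_mul_left (I := 𝓘(ℝ, EH)) (n := ∞)).mdifferentiable (by simp) _) w
  have h2 : (fun h : H => g * h) ∘ (fun h : H => g⁻¹ * h) = id := by funext h; simp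
  rw [h2, mfderiv_id, inv_mul_cancel] at h1
  exact ⟨_, h1.symm⟩

end LieGroup

/-! ### Vertical vectors: derivatives of sections and curvature. -/

section Vertical

variable {EH H 𝔤 EP P EM M : Type*}
  [NormedAddCommGroup EH] [NormedSpace ℝ EH] [FiniteDimensional ℝ EH]
  [TopologicalSpace H] [ChartedSpace EH H] [Group H] [LieGroup 𝓘(ℝ, EH) ∞ H]
  [NormedLieAlgebra 𝔤] [FiniteDimensional ℝ 𝔤]
  [NormedAddCommGroup EP] [NormedSpace ℝ EP] [FiniteDimensional ℝ EP]
  [TopologicalSpace P] [ChartedSpace EP P] [IsManifold 𝓘(ℝ, EP) ∞ P] [MulAction Hᵐᵒᵖ P]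
  [NormedAddCommGroup EM] [NormedSpace ℝ EM] [FiniteDimensional ℝ EM]
  [TopologicalSpace M] [ChartedSpace EM M] [IsManifold 𝓘(ℝ, EM) ∞ M]
  {𝔪 : CartanModel EH H 𝔤}

/-- A tangent vector which projects to zero is the value of a fundamental vector field. -/
theorem IsSmoothPrincipalBundle.exists_fundamentalVF_eq {proj : P → M}
    (hp : IsSmoothPrincipalBundle EH H EP EM proj) {p : P} {u : TangentSpace 𝓘(ℝ, EP) p}
    (hu : mfderiv 𝓘(ℝ, EP) 𝓘(ℝ, EM) proj p u = 0) :
    ∃ ξ : GroupLieAlgebra 𝓘(ℝ, EH) H, fundamentalVF P ξ p = u := by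
  obtain ⟨e, hx, hes, hets, he⟩ := hp.exists_trivialization (proj p)
  have hps : p ∈ e.source := e.mem_source.2 hx
  have hed : MDifferentiableAt 𝓘(ℝ, EP) (𝓘(ℝ, EM).prod 𝓘(ℝ, EH)) e p :=
    (hes.contMDiffAt (e.open_source.mem_nhds hps)).mdifferentiableAt (by simp)
  have hsd : MDifferentiableAt (𝓘(ℝ, EM).prod 𝓘(ℝ, EH)) 𝓘(ℝ, EP)
      e.toOpenPartialHomeomorph.symm (e p) :=
    (hets.contMDiffAt (e.open_target.mem_nhds (e.map_source hps))).mdifferentiableAt (by simp)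
  -- The derivative of the trivialization has a left inverse, so tangent vectors at `p` may be
  -- compared by their components in `EM × EH`.
  have hinj : ∀ v : TangentSpace 𝓘(ℝ, EP) p, mfderiv (𝓘(ℝ, EM).prod 𝓘(ℝ, EH)) 𝓘(ℝ, EP)
      e.toOpenPartialHomeomorph.symm (e p)
      (mfderiv 𝓘(ℝ, EP) (𝓘(ℝ, EM).prod 𝓘(ℝ, EH)) e p v) = v := by
    intro v
    have h1 := mfderiv_comp_apply p hsd hed v
    have h2 : e.toOpenPartialHomeomorph.symm ∘ e =ᶠ[nhds p] id := by
      filter_upwards [e.open_source.mem_nhds hps] with q hq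
      exact e.toOpenPartialHomeomorph.left_inv hq
    refine h1.symm.trans ?_
    rw [h2.mfderiv_eq, mfderiv_id]
    rfl
  have hfst : ∀ v : TangentSpace 𝓘(ℝ, EP) p,
      (mfderiv 𝓘(ℝ, EP) (𝓘(ℝ, EM).prod 𝓘(ℝ, EH)) e p v : EM × EH).1 =
        mfderiv 𝓘(ℝ, EP) 𝓘(ℝ, EM) proj p v := by
    intro v
    have h1 := mfderiv_comp_apply p (g := Prod.fst) mdifferentiableAt_fst hed v
    have h2 : Prod.fst ∘ e =ᶠ[nhds p] proj := by
      filter_upwards [e.open_source.mem_nhds hps] with q hq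
      exact e.coe_fst hq
    rw [mfderiv_fst] at h1
    refine h1.symm.trans ?_
    rw [h2.mfderiv_eq]
    rfl
  have hsnd : ∀ v : TangentSpace 𝓘(ℝ, EP) p,
      (mfderiv 𝓘(ℝ, EP) (𝓘(ℝ, EM).prod 𝓘(ℝ, EH)) e p v : EM × EH).2 =
        mfderiv 𝓘(ℝ, EP) 𝓘(ℝ, EH) (Prod.snd ∘ e) p v := by
    intro v
    have h1 := mfderiv_comp_apply p (g := Prod.snd) mdifferentiableAt_snd hed v
    rw [mfderiv_snd] at h1
    exact h1.symm
  -- In the trivialization the orbit map of `p` is `h ↦ (proj p, (e p).2 * h)`. Choosing `ξ` this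
  -- way matches the fibre component of `u`; the base components are both zero.
  obtain ⟨ξ, hξ⟩ := surjective_mfderiv_mul_left (EH := EH) (e p).2
    (mfderiv 𝓘(ℝ, EP) 𝓘(ℝ, EH) (Prod.snd ∘ e) p u : EH)
  have horb : ContMDiff 𝓘(ℝ, EH) 𝓘(ℝ, EP) ∞ fun h : H => op h • p :=
    hp.smooth_act.comp (contMDiff_const.prodMk contMDiff_id)
  refine ⟨ξ, ?_⟩
  have hv1 : mfderiv 𝓘(ℝ, EP) 𝓘(ℝ, EM) proj p (fundamentalVF P (H := H) ξ p) = 0 := by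
    have h1 := mfderiv_comp_apply_of_eq (1 : H) (g := proj) (f := fun h : H => op h • p) (y := p)
      (hp.smooth_proj.mdifferentiable (by simp) _) (horb.mdifferentiable (by simp) _)
      (by simp) ξ
    have h2 : proj ∘ (fun h : H => op h • p) = fun _ => proj p := funext fun h => hp.proj_act h p
    rw [h2, mfderiv_const] at h1
    exact h1.symm
  have hv2 : (mfderiv 𝓘(ℝ, EP) 𝓘(ℝ, EH) (Prod.snd ∘ e) p (fundamentalVF P (H := H) ξ p) : EH) =
      mfderiv 𝓘(ℝ, EP) 𝓘(ℝ, EH) (Prod.snd ∘ e) p u := by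
    have h1 := mfderiv_comp_apply_of_eq (1 : H) (g := Prod.snd ∘ e) (f := fun h : H => op h • p)
      (y := p) (mdifferentiableAt_snd.comp p hed) (horb.mdifferentiable (by simp) _)
      (by simp) ξ
    have h2 : (Prod.snd ∘ e) ∘ (fun h : H => op h • p) = fun h => (e p).2 * h :=
      funext fun h => by simp [he p hps h]
    rw [h2] at h1
    exact h1.symm.trans hξ
  rw [← hinj u, ← hinj (fundamentalVF P (H := H) ξ p)]
  congr 1
  exact Prod.ext ((hfst _).trans ((hv1.trans hu.symm).trans (hfst u).symm))
    ((hsnd _).trans (hv2.trans (hsnd u).symm))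

namespace CartanGeometry

variable {𝒢 : CartanGeometry 𝔪 EP P EM M}

theorem form_fundamentalVF (𝒢 : CartanGeometry 𝔪 EP P EM M) (ξ : GroupLieAlgebra 𝓘(ℝ, EH) H)
    (p : P) : 𝒢.form p (fundamentalVF P ξ p) = 𝔪.ι ξ := 𝒢.form_fundamental p ξ

/-- The derivative of a section along a fundamental vector field. -/
theorem mvfderiv_fundamentalVF (τ : 𝒢.Sections) (ξ : GroupLieAlgebra 𝓘(ℝ, EH) H) (p : P) :
    mvfderiv 𝓘(ℝ, EP) τ.1 p (fundamentalVF P ξ p) = -⁅(𝔪.ι ξ : 𝔤), τ.1 p⁆ := by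
  have horb : ContMDiff 𝓘(ℝ, EH) 𝓘(ℝ, EP) ∞ fun h : H => op h • p :=
    𝒢.isPrincipal.smooth_act.comp (contMDiff_const.prodMk contMDiff_id)
  have h1 := mfderiv_comp_apply_of_eq (1 : H) (g := τ.1) (f := fun h : H => op h • p) (y := p)
    ((smooth τ).mdifferentiable (by simp) _) (horb.mdifferentiable (by simp) _) (by simp) ξ
  -- This is equivariance along the orbit; differentiating the inversion produces the minus sign.
  have h2 : τ.1 ∘ (fun h : H => op h • p) = (fun h => 𝔪.Ad h (τ.1 p)) ∘ fun h : H => h⁻¹ :=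
    funext fun h => act τ h p
  have h3 := mfderiv_comp_apply_of_eq (1 : H) (g := fun h => 𝔪.Ad h (τ.1 p))
    (f := fun h : H => h⁻¹) (y := 1) ((𝔪.Ad_smooth _).mdifferentiable (by simp) _)
    ((contMDiff_inv 𝓘(ℝ, EH) ∞).mdifferentiable (by simp) _) (by simp) ξ
  rw [h2] at h1
  refine h1.symm.trans (h3.trans ?_)
  have h4 := mfderiv_inv_one (EH := EH) (H := H) ξ
  rw [← 𝔪.Ad_deriv, ← map_neg]
  exact congrArg (mvfderiv 𝓘(ℝ, EH) (fun h => 𝔪.Ad h (τ.1 p)) 1) h4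

/-- The derivative of a section along a vertical vector. -/
theorem mvfderiv_of_vertical (τ : 𝒢.Sections) {p : P} {u : TangentSpace 𝓘(ℝ, EP) p}
    (hu : mfderiv 𝓘(ℝ, EP) 𝓘(ℝ, EM) 𝒢.proj p u = 0) :
    mvfderiv 𝓘(ℝ, EP) τ.1 p u = -⁅𝒢.form p u, τ.1 p⁆ := by
  obtain ⟨ξ, rfl⟩ := 𝒢.isPrincipal.exists_fundamentalVF_eq hu
  rw [mvfderiv_fundamentalVF, form_fundamentalVF]

/-- The curvature vanishes on a vertical vector and the value of an invariant vector field. -/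
theorem curvature_vertical_vf (σ : 𝒢.Sections) {p : P} {u : TangentSpace 𝓘(ℝ, EP) p}
    (hu : mfderiv 𝓘(ℝ, EP) 𝓘(ℝ, EM) 𝒢.proj p u = 0) : curvature 𝒢 p u (vf σ p) = 0 := by
  obtain ⟨ξ, rfl⟩ := 𝒢.isPrincipal.exists_fundamentalVF_eq hu
  let X : SmoothVF EP P := ⟨fundamentalVF P ξ, contMDiff_fundamentalVF 𝒢.isPrincipal.smooth_act ξ⟩
  have h1 := dform_apply 𝒢 X (vf σ) p
  have h2 : (fun q => 𝒢.form q (X q)) = fun _ => (𝔪.ι ξ : 𝔤) :=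
    funext fun q => form_fundamentalVF 𝒢 ξ q
  have h3 : (fun q => 𝒢.form q (vf σ q)) = σ.1 := funext fun q => form_vf σ q
  have h4 : SmoothVF.bracket X (vf σ) p = 0 :=
    mlieBracket_fundamentalVF 𝒢.isPrincipal.smooth_act (vf σ).contMDiff
      (fun h p => vf_act σ h p) ξ p
  -- Of the three terms of `dω` only `ξ̃(σ) = -{ξ, σ}` survives, and it cancels against the term
  -- `{ω, ω}`.
  rw [h2, h3, h4, map_zero, mvfderiv_const] at h1
  have h5 : mvfderiv 𝓘(ℝ, EP) σ.1 p (X p) = -⁅(𝔪.ι ξ : 𝔤), σ.1 p⁆ :=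
    mvfderiv_fundamentalVF σ ξ p
  rw [h5] at h1
  rw [curvature, form_fundamentalVF, form_vf]
  refine (congrArg (· + ⁅(𝔪.ι ξ : 𝔤), σ.1 p⁆) h1).trans ?_
  simp only [zero_apply, sub_zero]
  exact neg_add_cancel _

end CartanGeometry

end Vertical

/-! ### Partitions of unity: prescribed values and lifts of vector fields. -/

section Gluing

variable {EH H 𝔤 EP P EM M : Type*}
  [NormedAddCommGroup EH] [NormedSpace ℝ EH] [FiniteDimensional ℝ EH]
  [TopologicalSpace H] [ChartedSpace EH H] [Group H] [LieGroup 𝓘(ℝ, EH) ∞ H]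
  [NormedLieAlgebra 𝔤] [FiniteDimensional ℝ 𝔤]
  [NormedAddCommGroup EP] [NormedSpace ℝ EP] [FiniteDimensional ℝ EP]
  [TopologicalSpace P] [ChartedSpace EP P] [IsManifold 𝓘(ℝ, EP) ∞ P] [MulAction Hᵐᵒᵖ P]
  [NormedAddCommGroup EM] [NormedSpace ℝ EM] [FiniteDimensional ℝ EM]
  [TopologicalSpace M] [ChartedSpace EM M] [IsManifold 𝓘(ℝ, EM) ∞ M]
  {𝔪 : CartanModel EH H 𝔤}

namespace CartanGeometry

variable {𝒢 : CartanGeometry 𝔪 EP P EM M}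

/-- Sections with values in given convex sets exist if they exist locally. -/
theorem exists_section_of_local [T2Space M] [SecondCountableTopology M]
    (𝒢 : CartanGeometry 𝔪 EP P EM M) (C : P → Set 𝔤) (hC : ∀ p, Convex ℝ (C p))
    (hloc : ∀ x : M, ∃ u : Set M, IsOpen u ∧ x ∈ u ∧ ∃ ρ : P → 𝔤,
      ContMDiffOn 𝓘(ℝ, EP) 𝓘(ℝ, 𝔤) ∞ ρ (𝒢.proj ⁻¹' u) ∧
      (∀ p ∈ 𝒢.proj ⁻¹' u, ∀ h : H, ρ (op h • p) = 𝔪.Ad h⁻¹ (ρ p)) ∧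
      ∀ p ∈ 𝒢.proj ⁻¹' u, ρ p ∈ C p) :
    ∃ σ : 𝒢.Sections, ∀ p, σ.1 p ∈ C p := by
  have : LocallyCompactSpace M := ChartedSpace.locallyCompactSpace EM M
  choose u hu hxu ρ hρs hρa hρC using hloc
  obtain ⟨f, hf⟩ := SmoothPartitionOfUnity.exists_isSubordinate 𝓘(ℝ, EM) isClosed_univ u hu
    (fun x _ => mem_iUnion.2 ⟨x, hxu x⟩)
  have hπ := 𝒢.isPrincipal.smooth_proj
  -- Nothing is known about `ρ i` away from `u i`, so each use of it is guarded by a nonvanishing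
  -- weight or by the support of the weight.
  have hsub : ∀ i p, f i (𝒢.proj p) ≠ 0 → p ∈ 𝒢.proj ⁻¹' u i := fun i p hp =>
    hf i (subset_tsupport _ hp)
  have hfin : ∀ p, (support fun i => f i (𝒢.proj p)).Finite := fun p =>
    f.locallyFinite.point_finite (𝒢.proj p)
  refine ⟨⟨fun p => ∑ᶠ i, f i (𝒢.proj p) • ρ i p, ?_, fun h p => ?_⟩, fun p => ?_⟩
  · refine contMDiff_finsum (fun i => contMDiff_of_tsupport fun p hp => ?_)
      ((f.locallyFinite.preimage_continuous hπ.continuous).subset fun i p hp => ?_)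
    · have h1 : p ∈ 𝒢.proj ⁻¹' tsupport (f i) :=
        closure_minimal (t := 𝒢.proj ⁻¹' tsupport (f i))
          (fun q hq => subset_tsupport (f i)
            (support_smul_subset_left (fun p => f i (𝒢.proj p)) (ρ i) hq))
          ((isClosed_tsupport _).preimage hπ.continuous) hp
      exact ((f i).contMDiff.comp hπ p).smul
        ((hρs i).contMDiffAt (((hu i).preimage hπ.continuous).mem_nhds (hf i h1)))
    · exact support_smul_subset_left _ _ hp
  · dsimp only
    rw [map_finsum (𝔪.Ad h⁻¹) (f := fun i => f i (𝒢.proj p) • ρ i p) ((hfin p).subset (support_smul_subset_left _ _))]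
    refine finsum_congr fun i => ?_
    rw [𝒢.isPrincipal.proj_act, map_smul]
    by_cases h0 : f i (𝒢.proj p) = 0
    · rw [h0, zero_smul, zero_smul]
    · rw [hρa i p (hsub i p h0) h]
  -- The weights are functions on `M`, so at a fixed `p` the sum is a convex combination of the
  -- local values at `p`.
  · exact f.finsum_smul_mem_convex (g := fun i _ => ρ i p) (mem_univ (𝒢.proj p))
      (fun i hi => hρC i p (hsub i p hi)) (hC p)

/-- Sections have arbitrary values at a given point. -/
theorem exists_section_apply_eq [T2Space M] [SecondCountableTopology M]
    (𝒢 : CartanGeometry 𝔪 EP P EM M) (p : P) (x : 𝔤) : ∃ σ : 𝒢.Sections, σ.1 p = x := by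
  -- The convex set is `{x}` at the point `p` and all of `𝔤` elsewhere.
  obtain ⟨σ, hσ⟩ := exists_section_of_local 𝒢 (fun q => {y | q = p → y = x})
    (fun q => by
      by_cases hq : q = p
      · simp [hq]
      · simp [hq, convex_univ]) (fun z => by
    obtain ⟨e, hz, hes, -, he⟩ := 𝒢.isPrincipal.exists_trivialization z
    -- This is the equivariant function that is constant along the base in the trivialization,
    -- normalized to be `x` at `p`. If `p` is outside the domain, `(e p).2` is an irrelevant
    -- constant, as the constraint is void there.
    refine ⟨e.baseSet, e.open_baseSet, hz, fun q => 𝔪.Ad ((e q).2⁻¹ * (e p).2) x, ?_, ?_, ?_⟩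
    · rw [← e.source_eq]
      exact (𝔪.Ad_smooth x).comp_contMDiffOn
        (((contMDiff_snd.comp_contMDiffOn hes).inv).mul contMDiffOn_const)
    · intro q hq h
      have hq' : q ∈ e.source := e.mem_source.2 hq
      dsimp only
      rw [he q hq' h, mul_inv_rev, mul_assoc, map_mul, Module.End.mul_apply]
    · rintro q hq rfl
      simp)
  exact ⟨σ, hσ p rfl⟩

variable (EH) in
/-- The lift of a vector field in a trivialization of the bundle, which has no component in the
direction of the fibre. -/
noncomputable def localLift {proj : P → M} (e : Trivialization H proj) (U : SmoothVF EM M) (q : P) :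
    TangentSpace 𝓘(ℝ, EP) q :=
  (mfderiv (𝓘(ℝ, EM).prod 𝓘(ℝ, EH)) 𝓘(ℝ, EP) e.toOpenPartialHomeomorph.symm (e q)
    ((U (e q).1, 0) : EM × EH) : EP)

section LocalLift

variable {proj : P → M} {e : Trivialization H proj}

theorem contMDiffOn_localLift (hes : ContMDiffOn 𝓘(ℝ, EP) (𝓘(ℝ, EM).prod 𝓘(ℝ, EH)) ∞ e e.source)
    (hets : ContMDiffOn (𝓘(ℝ, EM).prod 𝓘(ℝ, EH)) 𝓘(ℝ, EP) ∞ e.toOpenPartialHomeomorph.symm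
      e.target) (U : SmoothVF EM M) :
    ContMDiffOn 𝓘(ℝ, EP) 𝓘(ℝ, EP).tangent ∞
      (fun q => (⟨q, localLift EH e U q⟩ : TangentBundle 𝓘(ℝ, EP) P)) e.source := by
  have h1 := hets.contMDiffOn_tangentMapWithin (m := ∞) (by simp) e.open_target.uniqueMDiffOn
  have h2 : ContMDiffOn 𝓘(ℝ, EP) 𝓘(ℝ, EM).tangent ∞
      (fun q => (⟨(e q).1, U (e q).1⟩ : TangentBundle 𝓘(ℝ, EM) M)) e.source :=
    U.contMDiff.comp_contMDiffOn (contMDiff_fst.comp_contMDiffOn hes)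
  have h3 : ContMDiffOn 𝓘(ℝ, EP) 𝓘(ℝ, EH).tangent ∞
      (fun q => (⟨(e q).2, 0⟩ : TangentBundle 𝓘(ℝ, EH) H)) e.source :=
    (contMDiff_zeroSection ℝ (TangentSpace 𝓘(ℝ, EH) (M := H))).comp_contMDiffOn
      (contMDiff_snd.comp_contMDiffOn hes)
  have h4 := h1.comp ((contMDiff_equivTangentBundleProd_symm (n := ∞) (I := 𝓘(ℝ, EM)) (M := M)
    (I' := 𝓘(ℝ, EH)) (M' := H)).comp_contMDiffOn (h2.prodMk h3))
    (fun q hq => e.map_source hq)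
  refine h4.congr fun q hq => ?_
  have h5 := mfderivWithin_of_isOpen (I := 𝓘(ℝ, EM).prod 𝓘(ℝ, EH)) (I' := 𝓘(ℝ, EP))
    (f := e.toOpenPartialHomeomorph.symm) e.open_target (e.map_source hq)
  refine TotalSpace.ext (e.toOpenPartialHomeomorph.left_inv hq).symm ?_
  exact heq_of_eq (congrArg (fun L => L ((U (e q).1, 0) : EM × EH)) h5).symm

theorem mfderiv_proj_localLift (hp : ContMDiff 𝓘(ℝ, EP) 𝓘(ℝ, EM) ∞ proj)
    (hets : ContMDiffOn (𝓘(ℝ, EM).prod 𝓘(ℝ, EH)) 𝓘(ℝ, EP) ∞ e.toOpenPartialHomeomorph.symm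
      e.target) (U : SmoothVF EM M) {q : P} (hq : q ∈ e.source) :
    mfderiv 𝓘(ℝ, EP) 𝓘(ℝ, EM) proj q (localLift EH e U q) = U (proj q) := by
  have hsd : MDifferentiableAt (𝓘(ℝ, EM).prod 𝓘(ℝ, EH)) 𝓘(ℝ, EP)
      e.toOpenPartialHomeomorph.symm (e q) :=
    (hets.contMDiffAt (e.open_target.mem_nhds (e.map_source hq))).mdifferentiableAt (by simp)
  have h1 := mfderiv_comp_apply_of_eq (e q) (g := proj) (y := q) (hp.mdifferentiable (by simp) _)
    hsd (e.toOpenPartialHomeomorph.left_inv hq) ((U (e q).1, 0) : EM × EH)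
  have h2 : proj ∘ e.toOpenPartialHomeomorph.symm =ᶠ[nhds (e q)] Prod.fst := by
    filter_upwards [e.open_target.mem_nhds (e.map_source hq)] with y hy
    exact e.proj_symm_apply hy
  rw [h2.mfderiv_eq, mfderiv_fst] at h1
  refine h1.symm.trans ?_
  exact congrArg (fun x => (U x : EM)) (e.coe_fst hq)

/-- In the trivialization, right translation by `h` is the identity times `g ↦ g * h`, whose
derivative sends `(U, 0)` to `(U, 0)`. -/
theorem mfderiv_act_localLift (hb : IsSmoothPrincipalBundle EH H EP EM proj)
    (hets : ContMDiffOn (𝓘(ℝ, EM).prod 𝓘(ℝ, EH)) 𝓘(ℝ, EP) ∞ e.toOpenPartialHomeomorph.symm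
      e.target) (he : ∀ p ∈ e.source, ∀ h : H, e (op h • p) = ((e p).1, (e p).2 * h))
    (U : SmoothVF EM M) {q : P} (hq : q ∈ e.source) (h : H) :
    mfderiv 𝓘(ℝ, EP) 𝓘(ℝ, EP) (fun p : P => op h • p) q (localLift EH e U q) =
      localLift EH e U (op h • q) := by
  have hsd : ∀ q ∈ e.source, MDifferentiableAt (𝓘(ℝ, EM).prod 𝓘(ℝ, EH)) 𝓘(ℝ, EP)
      e.toOpenPartialHomeomorph.symm (e q) := fun q hq =>
    (hets.contMDiffAt (e.open_target.mem_nhds (e.map_source hq))).mdifferentiableAt (by simp)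
  have hact : ∀ q ∈ e.source, op h • q ∈ e.source := fun q hq =>
    e.mem_source.2 (by rw [hb.proj_act]; exact e.mem_source.1 hq)
  have hsm : ContMDiff 𝓘(ℝ, EP) 𝓘(ℝ, EP) ∞ fun p : P => op h • p :=
    hb.smooth_act.comp (contMDiff_id.prodMk contMDiff_const)
  have hr : MDifferentiable 𝓘(ℝ, EH) 𝓘(ℝ, EH) fun g : H => g * h :=
    (contMDiff_mul_right (n := ∞)).mdifferentiable (by simp)
  have h1 := mfderiv_comp_apply_of_eq (e q) (g := fun p : P => op h • p) (y := q)
    (hsm.mdifferentiable (by simp) _)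
    (hsd q hq) (e.toOpenPartialHomeomorph.left_inv hq) ((U (e q).1, 0) : EM × EH)
  have h2 := mfderiv_comp_apply_of_eq (e q) (g := e.toOpenPartialHomeomorph.symm)
    (f := Prod.map id fun g : H => g * h) (y := e (op h • q)) (hsd _ (hact q hq))
    (mdifferentiableAt_id.prodMap (hr _)) (he q hq h).symm ((U (e q).1, 0) : EM × EH)
  have h3 : (fun p : P => op h • p) ∘ e.toOpenPartialHomeomorph.symm =ᶠ[nhds (e q)]
      e.toOpenPartialHomeomorph.symm ∘ Prod.map id fun g : H => g * h := by
    filter_upwards [e.open_target.mem_nhds (e.map_source hq)] with y hy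
    have hys := e.toOpenPartialHomeomorph.map_target hy
    have h4 := he _ hys h
    rw [show e (e.toOpenPartialHomeomorph.symm y) = y from
      e.toOpenPartialHomeomorph.right_inv hy] at h4
    change _ = e.toOpenPartialHomeomorph.symm (y.1, y.2 * h)
    rw [← h4]
    exact (e.toOpenPartialHomeomorph.left_inv (hact _ hys)).symm
  rw [h3.mfderiv_eq] at h1
  refine h1.symm.trans (h2.trans ?_)
  have h5 : (mfderiv (𝓘(ℝ, EM).prod 𝓘(ℝ, EH)) (𝓘(ℝ, EM).prod 𝓘(ℝ, EH))
      (Prod.map id fun g : H => g * h) (e q) ((U (e q).1, 0) : EM × EH) : EM × EH) =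
      (U (e q).1, 0) := by
    rw [mfderiv_prodMap mdifferentiableAt_id (hr _), mfderiv_id]
    exact Prod.ext rfl
      (map_zero (mfderiv 𝓘(ℝ, EH) 𝓘(ℝ, EH) (fun g : H => g * h) (e q).2))
  unfold localLift
  rw [he q hq h]
  exact congrArg (mfderiv (𝓘(ℝ, EM).prod 𝓘(ℝ, EH)) 𝓘(ℝ, EP) e.toOpenPartialHomeomorph.symm
    ((e q).1, (e q).2 * h)) h5

end LocalLift

/-- Lifting the value of `U` is an affine, hence convex, condition on the value of the section, so
the invariant lifts given by local trivializations can be glued. -/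
theorem anchor_surjective [T2Space M] [SecondCountableTopology M]
    (𝒢 : CartanGeometry 𝔪 EP P EM M) : Function.Surjective (anchor (𝒢 := 𝒢)) := by
  intro U
  obtain ⟨σ, hσ⟩ := exists_section_of_local 𝒢
    (fun q => {y | mfderiv 𝓘(ℝ, EP) 𝓘(ℝ, EM) 𝒢.proj q ((𝒢.form q).symm y) = U (𝒢.proj q)})
    (fun q x hx y hy a b _ _ hab => by
      simp only [mem_ofPred_eq] at hx hy ⊢
      rw [map_add, map_smul, map_smul, map_add, map_smul, map_smul, hx, hy, ← add_smul, hab,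
        one_smul])
    (fun z => by
      obtain ⟨e, hz, hes, hets, he⟩ := 𝒢.isPrincipal.exists_trivialization z
      refine ⟨e.baseSet, e.open_baseSet, hz, fun q => 𝒢.form q (localLift EH e U q), ?_, ?_, ?_⟩
      · rw [← e.source_eq]
        intro q hq
        have h := (𝒢.form_smooth.contMDiffOn q hq).clm_bundle_apply (v := fun p => localLift EH e U p)
          (b := fun p => p) (contMDiffOn_localLift hes hets U q hq)
        have := (contMDiffWithinAt_totalSpace.1 h).2
        simpa using this
      · intro q hq h
        dsimp only
        rw [← mfderiv_act_localLift 𝒢.isPrincipal hets he U (e.mem_source.2 hq), 𝒢.form_act]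
      · intro q hq
        simp only [mem_ofPred_eq, ContinuousLinearEquiv.symm_apply_apply]
        exact mfderiv_proj_localLift 𝒢.isPrincipal.smooth_proj hets U (e.mem_source.2 hq))
  refine ⟨σ, ?_⟩
  ext x
  obtain ⟨p, rfl⟩ := exists_proj_eq 𝒢 x
  rw [anchor_proj]
  exact hσ p

end CartanGeometry

end Gluing

/-! ### The Lie algebroid and its self-representation. -/

section Algebroid

variable {EH H 𝔤 EP P EM M : Type*}
  [NormedAddCommGroup EH] [NormedSpace ℝ EH] [FiniteDimensional ℝ EH]
  [TopologicalSpace H] [ChartedSpace EH H] [Group H] [LieGroup 𝓘(ℝ, EH) ∞ H]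
  [NormedLieAlgebra 𝔤] [FiniteDimensional ℝ 𝔤]
  [NormedAddCommGroup EP] [NormedSpace ℝ EP] [FiniteDimensional ℝ EP]
  [TopologicalSpace P] [ChartedSpace EP P] [IsManifold 𝓘(ℝ, EP) ∞ P] [MulAction Hᵐᵒᵖ P]
  [NormedAddCommGroup EM] [NormedSpace ℝ EM] [FiniteDimensional ℝ EM]
  [TopologicalSpace M] [ChartedSpace EM M] [IsManifold 𝓘(ℝ, EM) ∞ M]
  {𝔪 : CartanModel EH H 𝔤}

namespace CartanGeometry

variable {𝒢 : CartanGeometry 𝔪 EP P EM M}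

theorem sections_ext {σ τ : 𝒢.Sections} (h : ∀ p, σ.1 p = τ.1 p) : σ = τ :=
  Subtype.ext (funext h)

theorem vf_add (σ τ : 𝒢.Sections) (p : P) : vf (σ + τ) p = vf σ p + vf τ p :=
  map_add (𝒢.form p).symm _ _

theorem vf_smul (c : ℝ) (σ : 𝒢.Sections) (p : P) : vf (c • σ) p = c • vf σ p :=
  map_smul (𝒢.form p).symm _ _

theorem vf_fn_smul (f : SmoothFn EM M) (σ : 𝒢.Sections) (p : P) :
    vf (f • σ) p = f (𝒢.proj p) • vf σ p :=
  map_smul (𝒢.form p).symm _ _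

theorem vf_algBr (σ τ : 𝒢.Sections) (p : P) :
    vf (algBr σ τ) p = mlieBracket 𝓘(ℝ, EP) (vf σ) (vf τ) p :=
  (𝒢.form p).symm_apply_apply _

theorem anchor_add (σ τ : 𝒢.Sections) : anchor (σ + τ) = anchor σ + anchor τ := by
  ext x
  obtain ⟨p, rfl⟩ := exists_proj_eq 𝒢 x
  rw [ContMDiffSection.coe_add, Pi.add_apply, anchor_proj, anchor_proj, anchor_proj, vf_add,
    map_add]

theorem anchor_smul (c : ℝ) (σ : 𝒢.Sections) : anchor (c • σ) = c • anchor σ := by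
  ext x
  obtain ⟨p, rfl⟩ := exists_proj_eq 𝒢 x
  rw [ContMDiffSection.coe_smul, Pi.smul_apply, anchor_proj, anchor_proj, vf_smul, map_smul]

theorem anchor_fn_smul (f : SmoothFn EM M) (σ : 𝒢.Sections) :
    anchor (f • σ) = f • anchor σ := by
  ext x
  obtain ⟨p, rfl⟩ := exists_proj_eq 𝒢 x
  rw [SmoothVF.fn_smul_apply, anchor_proj, anchor_proj, vf_fn_smul, map_smul]

theorem anchor_algBr (σ τ : 𝒢.Sections) :
    anchor (algBr σ τ) = SmoothVF.bracket (anchor σ) (anchor τ) := by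
  ext x
  obtain ⟨p, rfl⟩ := exists_proj_eq 𝒢 x
  rw [anchor_proj, vf_algBr]
  exact mfderiv_mlieBracket_of_related 𝒢.isPrincipal.smooth_proj
    (vf σ).mdifferentiableAt (vf τ).mdifferentiableAt (anchor σ).mdifferentiableAt
    (anchor τ).mdifferentiableAt (fun q => (anchor_proj σ q).symm)
    (fun q => (anchor_proj τ q).symm)

theorem mdifferentiableAt_section (σ : 𝒢.Sections) (p : P) :
    MDifferentiableAt 𝓘(ℝ, EP) 𝓘(ℝ, 𝔤) σ.1 p := (smooth σ).mdifferentiable (by simp) p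

theorem mdifferentiableAt_comp_proj (𝒢 : CartanGeometry 𝔪 EP P EM M) (f : SmoothFn EM M) (p : P) :
    MDifferentiableAt 𝓘(ℝ, EP) 𝓘(ℝ, ℝ) (fun q => f (𝒢.proj q)) p :=
  (f.contMDiff.comp 𝒢.isPrincipal.smooth_proj).mdifferentiable (by simp) p

/-- The derivative of a function pulled back from the base along an invariant vector field. -/
theorem mvfderiv_comp_proj (f : SmoothFn EM M) (σ : 𝒢.Sections) (p : P) :
    mvfderiv 𝓘(ℝ, EP) (fun q => f (𝒢.proj q)) p (vf σ p) =
      (anchor σ).deriv f (𝒢.proj p) := by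
  have h := mvfderiv_comp_apply p (g := f) (f.contMDiff.mdifferentiable (by simp) _)
    (𝒢.isPrincipal.smooth_proj.mdifferentiable (by simp) p) (vf σ p)
  rw [← anchor_proj] at h
  exact h

theorem D_apply (σ τ : 𝒢.Sections) (p : P) :
    (D σ τ).1 p = mvfderiv 𝓘(ℝ, EP) τ.1 p (vf σ p) := rfl

theorem isAlgebroidConnection_D : IsAlgebroidConnection (anchor (𝒢 := 𝒢)) D where
  add_left σ τ ε := sections_ext fun p => by
    refine Eq.trans ?_ (map_add (mvfderiv 𝓘(ℝ, EP) ε.1 p) (vf σ p) (vf τ p))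
    rw [← vf_add]; rfl
  smul_left c σ ε := sections_ext fun p => by
    refine Eq.trans ?_ (map_smul (mvfderiv 𝓘(ℝ, EP) ε.1 p) c (vf σ p))
    rw [← vf_smul]; rfl
  fn_smul_left f σ ε := sections_ext fun p => by
    refine Eq.trans ?_ (map_smul (mvfderiv 𝓘(ℝ, EP) ε.1 p) (f (𝒢.proj p)) (vf σ p))
    rw [← vf_fn_smul]; rfl
  add_right σ ε ε' := sections_ext fun p =>
    congrArg (fun L => L (vf σ p))
      (mvfderiv_add (mdifferentiableAt_section ε p) (mdifferentiableAt_section ε' p))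
  smul_right c σ ε := sections_ext fun p => by
    -- The scalar is treated as a constant function, whose derivative term in the product rule
    -- vanishes.
    have h := mvfderiv_smul (I := 𝓘(ℝ, EP)) (mdifferentiableAt_const (c := c) (x := p))
      (mdifferentiableAt_section ε p)
    have h1 := congrArg (fun L => L (vf σ p)) h
    rw [mvfderiv_const] at h1
    simp only [smul_apply, add_apply, ContinuousLinearMap.smulRight_apply, zero_apply, zero_smul,
      add_zero] at h1
    exact h1
  leibniz f σ ε := sections_ext fun p => by
    have h := congrArg (fun L => L (vf σ p)) (mvfderiv_smul (I := 𝓘(ℝ, EP))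
      (mdifferentiableAt_comp_proj 𝒢 f p) (mdifferentiableAt_section ε p))
    refine h.trans ?_
    simp only [add_apply, smul_apply, ContinuousLinearMap.smulRight_apply, mvfderiv_comp_proj]
    rfl

theorem isAlgebroidRepresentation_D :
    IsAlgebroidRepresentation (anchor (𝒢 := 𝒢)) algBr D where
  toIsAlgebroidConnection := isAlgebroidConnection_D
  flat σ τ ε := sections_ext fun p => by
    rw [D_apply, vf_algBr, mvfderiv_mlieBracket (smooth ε p) (vf σ).mdifferentiableAt
      (vf τ).mdifferentiableAt]
    rfl

/-- Each bracket identity for sections is `ω` applied to the corresponding identity for vector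
fields on `P`. -/
theorem isLieAlgebroid : IsLieAlgebroid (anchor (𝒢 := 𝒢)) algBr where
  anchor_add := anchor_add
  anchor_smul := anchor_fn_smul
  skew σ τ := sections_ext fun p => by
    refine Eq.trans ?_ (map_neg (𝒢.form p) _)
    exact congrArg (𝒢.form p) mlieBracket_swap_apply
  add_right σ τ τ' := sections_ext fun p => by
    refine Eq.trans ?_ (map_add (𝒢.form p) _ _)
    refine congrArg (𝒢.form p) ?_
    rw [show SmoothVF.bracket (vf σ) (vf (τ + τ')) p =
      mlieBracket 𝓘(ℝ, EP) (vf σ) (vf τ + vf τ' : SmoothVF EP P) p by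
        rw [show vf (τ + τ') = vf τ + vf τ' from ContMDiffSection.ext (vf_add τ τ')]; rfl]
    exact mlieBracket_add_right (vf τ).mdifferentiableAt (vf τ').mdifferentiableAt
  smul_right c σ τ := sections_ext fun p => by
    refine Eq.trans ?_ (map_smul (𝒢.form p) _ _)
    refine congrArg (𝒢.form p) ?_
    rw [show SmoothVF.bracket (vf σ) (vf (c • τ)) p =
      mlieBracket 𝓘(ℝ, EP) (vf σ) (c • vf τ : SmoothVF EP P) p by
        rw [show vf (c • τ) = c • vf τ from ContMDiffSection.ext (vf_smul c τ)]; rfl]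
    exact mlieBracket_const_smul_right (vf τ).mdifferentiableAt
  leibniz f σ τ := sections_ext fun p => by
    have h1 : (vf (f • τ) : ∀ p : P, TangentSpace 𝓘(ℝ, EP) p) =
        (fun q => f (𝒢.proj q)) • (vf τ : ∀ p : P, TangentSpace 𝓘(ℝ, EP) p) :=
      funext fun q => vf_fn_smul f τ q
    have h2 := mlieBracket_smul_right (V := vf σ) (mdifferentiableAt_comp_proj 𝒢 f p)
      (vf τ).mdifferentiableAt
    rw [← h1, mvfderiv_comp_proj] at h2
    refine (congrArg (𝒢.form p) h2).trans ?_
    rw [map_add, map_smul, map_smul, form_vf, add_comm]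
    rfl
  jacobi ρ σ τ := sections_ext fun p => by
    refine Eq.trans ?_ (map_add (𝒢.form p) _ _)
    refine congrArg (𝒢.form p) ?_
    have hb : ∀ σ τ : 𝒢.Sections, (vf (algBr σ τ) : ∀ p : P, TangentSpace 𝓘(ℝ, EP) p) =
      mlieBracket 𝓘(ℝ, EP) (vf σ) (vf τ) := fun σ τ => funext (vf_algBr σ τ)
    change mlieBracket _ _ (vf (algBr σ τ)) p = mlieBracket _ (vf (algBr ρ σ)) _ p +
      mlieBracket _ _ (vf (algBr ρ τ)) p
    rw [hb, hb, hb]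
    have hle : minSmoothness ℝ 2 ≤ ∞ := by
      rw [minSmoothness_of_isRCLikeNormedField]; exact ENat.LEInfty.out
    exact leibniz_identity_mlieBracket_apply ((vf ρ).contMDiff.contMDiffAt.of_le hle)
      ((vf σ).contMDiff.contMDiffAt.of_le hle) ((vf τ).contMDiff.contMDiffAt.of_le hle)
  anchor_br := anchor_algBr

end CartanGeometry

end Algebroid

/-! ### Horizontality of the curvature, and the two connections. -/

section Connections

variable {EH H 𝔤 EP P EM M : Type*}
  [NormedAddCommGroup EH] [NormedSpace ℝ EH] [FiniteDimensional ℝ EH]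
  [TopologicalSpace H] [ChartedSpace EH H] [Group H] [LieGroup 𝓘(ℝ, EH) ∞ H]
  [NormedLieAlgebra 𝔤] [FiniteDimensional ℝ 𝔤]
  [NormedAddCommGroup EP] [NormedSpace ℝ EP] [FiniteDimensional ℝ EP]
  [TopologicalSpace P] [ChartedSpace EP P] [IsManifold 𝓘(ℝ, EP) ∞ P] [MulAction Hᵐᵒᵖ P]
  [NormedAddCommGroup EM] [NormedSpace ℝ EM] [FiniteDimensional ℝ EM]
  [TopologicalSpace M] [ChartedSpace EM M] [IsManifold 𝓘(ℝ, EM) ∞ M]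
  {𝔪 : CartanModel EH H 𝔤}

namespace CartanGeometry

variable {𝒢 : CartanGeometry 𝔪 EP P EM M}

theorem fn_smul_add (f : SmoothFn EM M) (σ τ : 𝒢.Sections) : f • (σ + τ) = f • σ + f • τ :=
  sections_ext fun p => smul_add (f (𝒢.proj p)) (σ.1 p) (τ.1 p)

theorem fn_smul_sub (f : SmoothFn EM M) (σ τ : 𝒢.Sections) : f • (σ - τ) = f • σ - f • τ :=
  sections_ext fun p => smul_sub (f (𝒢.proj p)) (σ.1 p) (τ.1 p)

theorem algBr_add_left (σ σ' τ : 𝒢.Sections) : algBr (σ + σ') τ = algBr σ τ + algBr σ' τ := by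
  rw [isLieAlgebroid.skew, isLieAlgebroid.add_right, isLieAlgebroid.skew σ,
    isLieAlgebroid.skew σ']
  abel

theorem algBr_smul_left (c : ℝ) (σ τ : 𝒢.Sections) : algBr (c • σ) τ = c • algBr σ τ := by
  rw [isLieAlgebroid.skew, isLieAlgebroid.smul_right, isLieAlgebroid.skew σ, smul_neg]

theorem algBr_sub_left (σ σ' τ : 𝒢.Sections) : algBr (σ - σ') τ = algBr σ τ - algBr σ' τ := by
  rw [eq_sub_iff_add_eq, ← algBr_add_left, sub_add_cancel]

theorem algBr_sub_right (σ τ τ' : 𝒢.Sections) : algBr σ (τ - τ') = algBr σ τ - algBr σ τ' := by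
  rw [eq_sub_iff_add_eq, ← isLieAlgebroid.add_right, sub_add_cancel]

/-- The curvature of the geometry on a pair of sections. -/
noncomputable def curvatureSection (σ τ : 𝒢.Sections) : 𝒢.Sections :=
  D σ τ - D τ σ - algBr σ τ + lieBr σ τ

theorem curvature_vf (σ τ : 𝒢.Sections) (p : P) :
    curvature 𝒢 p (vf σ p) (vf τ p) = (curvatureSection σ τ).1 p := by
  have h := dform_apply 𝒢 (vf σ) (vf τ) p
  have h1 : ∀ σ : 𝒢.Sections, (fun q => 𝒢.form q (vf σ q)) = σ.1 :=
    fun σ => funext fun q => form_vf σ q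
  rw [h1, h1] at h
  rw [curvature, form_vf, form_vf]
  exact congrArg (· + ⁅σ.1 p, τ.1 p⁆) h

/-- Pointwise claims about the curvature reduce through this to invariant fields, on which it is
computed by `curvature_vf`. -/
theorem exists_vf_eq [T2Space M] [SecondCountableTopology M] (𝒢 : CartanGeometry 𝔪 EP P EM M)
    (p : P) (v : TangentSpace 𝓘(ℝ, EP) p) : ∃ σ : 𝒢.Sections, vf σ p = v := by
  obtain ⟨σ, hσ⟩ := exists_section_apply_eq 𝒢 p (𝒢.form p v)
  exact ⟨σ, (𝒢.form p).injective (by rw [form_vf, hσ])⟩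

theorem curvature_swap [T2Space M] [SecondCountableTopology M] (p : P)
    (u v : TangentSpace 𝓘(ℝ, EP) p) : curvature 𝒢 p u v = -curvature 𝒢 p v u := by
  obtain ⟨σ, rfl⟩ := exists_vf_eq 𝒢 p u
  obtain ⟨τ, rfl⟩ := exists_vf_eq 𝒢 p v
  have h : lieBr σ τ = -lieBr τ σ := sections_ext fun p => (lie_skew (σ.1 p) (τ.1 p)).symm
  have h2 : curvatureSection σ τ = -curvatureSection τ σ := by
    rw [curvatureSection, curvatureSection, h, isLieAlgebroid.skew σ τ]
    abel
  rw [curvature_vf, curvature_vf, h2]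
  rfl

theorem curvature_sub_left (p : P) (u u' v : TangentSpace 𝓘(ℝ, EP) p) :
    curvature 𝒢 p (u - u') v = curvature 𝒢 p u v - curvature 𝒢 p u' v := by
  simp only [curvature, map_sub, sub_lie, sub_apply]
  abel

/-- The curvature is horizontal. -/
theorem curvature_congr [T2Space M] [SecondCountableTopology M] {p : P}
    {u u' v v' : TangentSpace 𝓘(ℝ, EP) p}
    (hu : mfderiv 𝓘(ℝ, EP) 𝓘(ℝ, EM) 𝒢.proj p u = mfderiv 𝓘(ℝ, EP) 𝓘(ℝ, EM) 𝒢.proj p u')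
    (hv : mfderiv 𝓘(ℝ, EP) 𝓘(ℝ, EM) 𝒢.proj p v = mfderiv 𝓘(ℝ, EP) 𝓘(ℝ, EM) 𝒢.proj p v') :
    curvature 𝒢 p u v = curvature 𝒢 p u' v' := by
  have key : ∀ {u u' : TangentSpace 𝓘(ℝ, EP) p} (v : TangentSpace 𝓘(ℝ, EP) p),
      mfderiv 𝓘(ℝ, EP) 𝓘(ℝ, EM) 𝒢.proj p u = mfderiv 𝓘(ℝ, EP) 𝓘(ℝ, EM) 𝒢.proj p u' →
      curvature 𝒢 p u v = curvature 𝒢 p u' v := by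
    intro u u' v h
    obtain ⟨σ, rfl⟩ := exists_vf_eq 𝒢 p v
    rw [← sub_eq_zero, ← curvature_sub_left]
    exact curvature_vertical_vf σ (by rw [map_sub, h, sub_self])
  -- Skew-symmetry moves the second argument into the first slot.
  rw [key v hu, curvature_swap, key u' hv, ← curvature_swap]

theorem mfderiv_proj_vf {σ : 𝒢.Sections} {U : SmoothVF EM M} (h : anchor σ = U) (p : P) :
    mfderiv 𝓘(ℝ, EP) 𝓘(ℝ, EM) 𝒢.proj p (vf σ p) = U (𝒢.proj p) := by
  rw [← h, anchor_proj]

theorem existsUnique_isCurvatureForm [T2Space M] [SecondCountableTopology M]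
    (𝒢 : CartanGeometry 𝔪 EP P EM M) : ∃! κ, IsCurvatureForm 𝒢 κ := by
  choose s hs using anchor_surjective 𝒢
  refine ⟨fun U V => curvatureSection (s U) (s V), fun U V p u v hu hv => ?_, fun κ hκ => ?_⟩
  · rw [← curvature_vf]
    exact curvature_congr (by rw [hu, mfderiv_proj_vf (hs U)])
      (by rw [hv, mfderiv_proj_vf (hs V)])
  · funext U V
    refine sections_ext fun p => ?_
    rw [hκ U V p _ _ (mfderiv_proj_vf (hs U) p) (mfderiv_proj_vf (hs V) p), curvature_vf]

/-- Operators given by an expression in a lift of the vector field exist uniquely. -/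
theorem existsUnique_of_lift [T2Space M] [SecondCountableTopology M]
    {F : 𝒢.Sections → 𝒢.Sections → 𝒢.Sections}
    (hF : ∀ ρ ρ' : 𝒢.Sections, anchor ρ = anchor ρ' → ∀ σ, F ρ σ = F ρ' σ) :
    ∃! nabla : SmoothVF EM M → 𝒢.Sections → 𝒢.Sections,
      ∀ (U : SmoothVF EM M) (ρ : 𝒢.Sections), anchor ρ = U → ∀ σ, nabla U σ = F ρ σ := by
  choose s hs using anchor_surjective 𝒢
  refine ⟨fun U σ => F (s U) σ, fun U ρ h σ => hF _ _ (by rw [hs, h]) σ, fun nabla h => ?_⟩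
  funext U σ
  exact h U (s U) (hs U) σ

/-- The difference of the two invariant fields is vertical, and the derivative of `σ` along it is
exactly compensated by the change of the bracket term. -/
theorem tractor_congr {ρ ρ' : 𝒢.Sections} (h : anchor ρ = anchor ρ') (σ : 𝒢.Sections) :
    D ρ σ + lieBr ρ σ = D ρ' σ + lieBr ρ' σ := by
  refine sections_ext fun p => ?_
  have h1 := mvfderiv_of_vertical σ (u := vf ρ p - vf ρ' p)
    (by rw [map_sub, mfderiv_proj_vf h, mfderiv_proj_vf rfl, sub_self])
  rw [map_sub, map_sub, form_vf, form_vf, sub_lie, neg_sub, sub_eq_sub_iff_add_eq_add] at h1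
  refine h1.trans ?_
  exact add_comm _ _

/-- A rearrangement of the curvature formula, which yields both the independence of the lift and the
comparison of the connections. -/
theorem blaom_eq (ρ σ : 𝒢.Sections) :
    D σ ρ - algBr σ ρ = D ρ σ + lieBr ρ σ - curvatureSection ρ σ := by
  rw [curvatureSection, isLieAlgebroid.skew ρ σ]
  abel

/-- Here the lift itself is differentiated, so independence is not visible directly. It follows from
`blaom_eq`, since the tractor expression and the horizontal curvature depend only on the anchor. -/
theorem blaom_congr [T2Space M] [SecondCountableTopology M] {ρ ρ' : 𝒢.Sections}
    (h : anchor ρ = anchor ρ') (σ : 𝒢.Sections) :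
    D σ ρ - algBr σ ρ = D σ ρ' - algBr σ ρ' := by
  have h1 : curvatureSection ρ σ = curvatureSection ρ' σ := sections_ext fun p => by
    rw [← curvature_vf, ← curvature_vf]
    exact curvature_congr (by rw [mfderiv_proj_vf h, mfderiv_proj_vf rfl]) rfl
  rw [blaom_eq, blaom_eq, tractor_congr h, h1]

theorem IsTractorConnection.isLinearConnection [T2Space M] [SecondCountableTopology M]
    {nabla : SmoothVF EM M → 𝒢.Sections → 𝒢.Sections} (h : IsTractorConnection 𝒢 nabla) :
    IsLinearConnection nabla where
  add_left U V ε := by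
    obtain ⟨ρ, rfl⟩ := anchor_surjective 𝒢 U
    obtain ⟨τ, rfl⟩ := anchor_surjective 𝒢 V
    rw [h _ ρ rfl, h _ τ rfl, h _ (ρ + τ) (anchor_add ρ τ), isAlgebroidConnection_D.add_left,
      show lieBr (ρ + τ) ε = lieBr ρ ε + lieBr τ ε from
        sections_ext fun p => add_lie (ρ.1 p) (τ.1 p) (ε.1 p)]
    abel
  smul_left c U ε := by
    obtain ⟨ρ, rfl⟩ := anchor_surjective 𝒢 U
    rw [h _ ρ rfl, h _ (c • ρ) (anchor_smul c ρ), isAlgebroidConnection_D.smul_left,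
      show lieBr (c • ρ) ε = c • lieBr ρ ε from
        sections_ext fun p => smul_lie c (ρ.1 p) (ε.1 p), smul_add]
  fn_smul_left f U ε := by
    obtain ⟨ρ, rfl⟩ := anchor_surjective 𝒢 U
    rw [h _ ρ rfl, h _ (f • ρ) (anchor_fn_smul f ρ), isAlgebroidConnection_D.fn_smul_left,
      show lieBr (f • ρ) ε = f • lieBr ρ ε from
        sections_ext fun p => smul_lie (f (𝒢.proj p)) (ρ.1 p) (ε.1 p), fn_smul_add]
  add_right U ε ε' := by
    obtain ⟨ρ, rfl⟩ := anchor_surjective 𝒢 U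
    rw [h _ ρ rfl, h _ ρ rfl, h _ ρ rfl, isAlgebroidConnection_D.add_right,
      show lieBr ρ (ε + ε') = lieBr ρ ε + lieBr ρ ε' from
        sections_ext fun p => lie_add (ρ.1 p) (ε.1 p) (ε'.1 p)]
    abel
  smul_right c U ε := by
    obtain ⟨ρ, rfl⟩ := anchor_surjective 𝒢 U
    rw [h _ ρ rfl, h _ ρ rfl, isAlgebroidConnection_D.smul_right,
      show lieBr ρ (c • ε) = c • lieBr ρ ε from
        sections_ext fun p => lie_smul c (ρ.1 p) (ε.1 p), smul_add]
  leibniz f U ε := by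
    obtain ⟨ρ, rfl⟩ := anchor_surjective 𝒢 U
    rw [h _ ρ rfl, h _ ρ rfl, isAlgebroidConnection_D.leibniz,
      show lieBr ρ (f • ε) = f • lieBr ρ ε from
        sections_ext fun p => lie_smul (f (𝒢.proj p)) (ρ.1 p) (ε.1 p), fn_smul_add]
    abel

/-- The lift sits in the differentiated slot: linearity over functions in `U` holds because the
Leibniz terms of `D` and of the bracket cancel. The Leibniz rule in the section comes from the
bracket alone, by skew-symmetry. -/
theorem IsBlaomConnection.isLinearConnection [T2Space M] [SecondCountableTopology M]
    {nabla : SmoothVF EM M → 𝒢.Sections → 𝒢.Sections} (h : IsBlaomConnection 𝒢 nabla) :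
    IsLinearConnection nabla where
  add_left U V ε := by
    obtain ⟨ρ, rfl⟩ := anchor_surjective 𝒢 U
    obtain ⟨τ, rfl⟩ := anchor_surjective 𝒢 V
    rw [h _ ρ rfl, h _ τ rfl, h _ (ρ + τ) (anchor_add ρ τ), isAlgebroidConnection_D.add_right,
      isLieAlgebroid.add_right]
    abel
  smul_left c U ε := by
    obtain ⟨ρ, rfl⟩ := anchor_surjective 𝒢 U
    rw [h _ ρ rfl, h _ (c • ρ) (anchor_smul c ρ), isAlgebroidConnection_D.smul_right,
      isLieAlgebroid.smul_right, smul_sub]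
  fn_smul_left f U ε := by
    obtain ⟨ρ, rfl⟩ := anchor_surjective 𝒢 U
    rw [h _ ρ rfl, h _ (f • ρ) (anchor_fn_smul f ρ), isAlgebroidConnection_D.leibniz,
      isLieAlgebroid.leibniz, fn_smul_sub]
    abel
  add_right U ε ε' := by
    obtain ⟨ρ, rfl⟩ := anchor_surjective 𝒢 U
    rw [h _ ρ rfl, h _ ρ rfl, h _ ρ rfl, isAlgebroidConnection_D.add_left, algBr_add_left]
    abel
  smul_right c U ε := by
    obtain ⟨ρ, rfl⟩ := anchor_surjective 𝒢 U
    rw [h _ ρ rfl, h _ ρ rfl, isAlgebroidConnection_D.smul_left, algBr_smul_left, smul_sub]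
  leibniz f U ε := by
    obtain ⟨ρ, rfl⟩ := anchor_surjective 𝒢 U
    have hn : f • (-algBr ρ ε) = -(f • algBr ρ ε) :=
      sections_ext fun p => smul_neg (f (𝒢.proj p)) ((algBr ρ ε).1 p)
    rw [h _ ρ rfl, h _ ρ rfl, isAlgebroidConnection_D.fn_smul_left, isLieAlgebroid.skew (f • ε),
      isLieAlgebroid.leibniz, fn_smul_sub, isLieAlgebroid.skew ε, hn]
    abel

theorem IsBlaomConnection.isCompatibleWithBracket [T2Space M] [SecondCountableTopology M]
    {nabla : SmoothVF EM M → 𝒢.Sections → 𝒢.Sections} (h : IsBlaomConnection 𝒢 nabla) :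
    IsCompatibleWithBracket (anchor (𝒢 := 𝒢)) algBr nabla := by
  intro U σ τ
  obtain ⟨ρ, rfl⟩ := anchor_surjective 𝒢 U
  -- The anchor of `-⟦σ, ρ⟧` cancels the term `[Π(σ), U]` of `∇^*_σ U`, so `D_σ ρ` is a lift of
  -- `∇^*_σ U`.
  have hdual : ∀ σ : 𝒢.Sections, anchor (D σ ρ) = dualOnVF anchor nabla σ (anchor ρ) := by
    intro σ
    rw [dualOnVF, h _ ρ rfl, ← anchor_algBr, ← anchor_add, sub_add_cancel]
  -- With these lifts the second-order terms in `D` match by flatness, the mixed terms cancel in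
  -- pairs by skew-symmetry, and the triple brackets match by the Jacobi identity.
  rw [h _ ρ rfl, h _ ρ rfl, h _ ρ rfl, h _ _ (hdual τ), h _ _ (hdual σ),
    isAlgebroidRepresentation_D.flat, algBr_sub_left, algBr_sub_right,
    isLieAlgebroid.skew (D σ ρ) τ, isLieAlgebroid.jacobi σ τ ρ,
    isLieAlgebroid.skew (algBr σ ρ) τ]
  abel

theorem tractor_sub_blaom [T2Space M] [SecondCountableTopology M]
    {κ : SmoothVF EM M → SmoothVF EM M → 𝒢.Sections}
    {nablaT nablaC : SmoothVF EM M → 𝒢.Sections → 𝒢.Sections} (hκ : IsCurvatureForm 𝒢 κ)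
    (hT : IsTractorConnection 𝒢 nablaT) (hC : IsBlaomConnection 𝒢 nablaC) (ρ σ : 𝒢.Sections) :
    nablaT (anchor ρ) σ - nablaC (anchor ρ) σ = κ (anchor ρ) (anchor σ) := by
  rw [hT _ ρ rfl, hC _ ρ rfl, blaom_eq, sub_sub_cancel]
  refine sections_ext fun p => ?_
  rw [hκ _ _ p _ _ (mfderiv_proj_vf rfl p) (mfderiv_proj_vf rfl p), curvature_vf]

end CartanGeometry

end Connections

theorem mainTheorem4
    {EH H 𝔤 EP P EM M : Type*}
    [NormedAddCommGroup EH] [NormedSpace ℝ EH] [FiniteDimensional ℝ EH]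
    [TopologicalSpace H] [ChartedSpace EH H] [Group H] [LieGroup 𝓘(ℝ, EH) ∞ H]
    [NormedLieAlgebra 𝔤] [FiniteDimensional ℝ 𝔤]
    [NormedAddCommGroup EP] [NormedSpace ℝ EP] [FiniteDimensional ℝ EP]
    [TopologicalSpace P] [ChartedSpace EP P] [IsManifold 𝓘(ℝ, EP) ∞ P] [MulAction Hᵐᵒᵖ P]
    [NormedAddCommGroup EM] [NormedSpace ℝ EM] [FiniteDimensional ℝ EM]
    [TopologicalSpace M] [ChartedSpace EM M] [IsManifold 𝓘(ℝ, EM) ∞ M]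
    [T2Space M] [SecondCountableTopology M]
    (𝔪 : CartanModel EH H 𝔤) (𝒢 : CartanGeometry 𝔪 EP P EM M) :
    IsLieAlgebroid (𝒢.anchor) 𝒢.algBr ∧
    IsAlgebroidRepresentation 𝒢.anchor 𝒢.algBr 𝒢.D ∧
    Function.Surjective 𝒢.anchor ∧
    (∃! κ, 𝒢.IsCurvatureForm κ) ∧
    (∃! nablaT, 𝒢.IsTractorConnection nablaT) ∧
    (∃! nablaC, 𝒢.IsBlaomConnection nablaC) ∧
    ∀ κ nablaT nablaC, 𝒢.IsCurvatureForm κ → 𝒢.IsTractorConnection nablaT →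
      𝒢.IsBlaomConnection nablaC →
      IsLinearConnection nablaT ∧ IsLinearConnection nablaC ∧
      IsCompatibleWithBracket 𝒢.anchor 𝒢.algBr nablaC ∧
      ∀ ρ σ : 𝒢.Sections,
        nablaT (𝒢.anchor ρ) σ - nablaC (𝒢.anchor ρ) σ = κ (𝒢.anchor ρ) (𝒢.anchor σ) := by
  refine ⟨CartanGeometry.isLieAlgebroid, CartanGeometry.isAlgebroidRepresentation_D,
    𝒢.anchor_surjective, 𝒢.existsUnique_isCurvatureForm,
    CartanGeometry.existsUnique_of_lift fun ρ ρ' h σ => CartanGeometry.tractor_congr h σ,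
    CartanGeometry.existsUnique_of_lift fun ρ ρ' h σ => CartanGeometry.blaom_congr h σ, ?_⟩
  intro κ nablaT nablaC hκ hT hC
  exact ⟨hT.isLinearConnection, hC.isLinearConnection, hC.isCompatibleWithBracket,
    CartanGeometry.tractor_sub_blaom hκ hT hC⟩
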